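/- Let $(U_i)_{i\ge 1}$ be independent random variables, each uniformly distributed on $[0,1]$. For $n\ge 1$ let $F_n(t)=n^{-1}\,\#\{1\le i\le n: U_i\le t\}$ be the empirical distribution function, $F_n^{\leftarrow}(t)=\inf\{s\ge 0: F_n(s)\ge t\}$ its left-continuous inverse, and $\alpha_n(t)=\sqrt n\,(F_n(t)-t)$ and $\beta_n(t)=\sqrt n\,(F_n^{\leftarrow}(t)-t)$ the uniform empirical and quantile processes on $[0,1]$. For $0<h<1$ and $s\in[0,1]$ put $$\mathcal D_{n,h,0}(s)=\alpha_n(hs)-\alpha_n(0),\qquad \mathcal D'_{n,h,0}(s)=\beta_n(hs)-\beta_n(0),$$ and let $\|g\|=\sup_{0\le s\le 1}|g(s)|$. Write $\log_2 u=\log\log(\max(u,3))$ and $$r_n(h)=\Big(\big(h\log_2 n/n\big)^{1/2}\,\big(2\log_2 n+\log(nh)\big)\Big)^{1/2}.$$ Let $(\mathfrak h_n)_{n\ge1}$ and $(h_n)_{n\ge1}$ be two sequences of strictly positive constants with $\mathfrak h_n<\tfrac12 h_n$ for all $n\ge 1$, each of which satisfies the following conditions (stated for $h_n$): for all large $n$,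 $h_n$ is non-increasing and $nh_n$ is non-decreasing in $n$, and $h_n\to0$, $nh_n\to\infty$ and $nh_n/\log_2 n\to\infty$ as $n\to\infty$. Then, almost surely, $$\limsup_{n\to\infty}\ \sup_{\mathfrak h_n\le h\le h_n}\ r_n(h)^{-1}\,\big\|\mathcal D_{n,h,0}+\mathcal D'_{n,h,0}\big\|\ \le\ 2^{1/2}.$$ (For all large $n$ one has $h_n<1$ and $r_n(h)>0$ for $\mathfrak h_n\le h\le h_n$, so that the expression is defined.) -/

import Mathlib

open MeasureTheory ProbabilityTheory Filter Topology
open scoped ENNReal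

namespace TailEmpirical

noncomputable section

/-- The iterated logarithm `log (log (max u 3))`. -/
def log₂ (u : ℝ) : ℝ := Real.log (Real.log (max u 3))

/-- The empirical distribution function of the first `n` terms `u 0, …, u (n - 1)` of the sample. -/
def empCdf (u : ℕ → ℝ) (n : ℕ) (t : ℝ) : ℝ :=
  (n : ℝ)⁻¹ * (((Finset.range n).filter (fun i => u i ≤ t)).card : ℝ)

/-- The left-continuous inverse `inf {s ≥ 0 : F_n(s) ≥ t}` of the empirical distribution function. -/
def empQuantile (u : ℕ → ℝ) (n : ℕ) (t : ℝ) : ℝ :=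
  sInf {s : ℝ | 0 ≤ s ∧ t ≤ empCdf u n s}

/-- The uniform empirical process `α_n`. -/
def empProcess (u : ℕ → ℝ) (n : ℕ) (t : ℝ) : ℝ :=
  Real.sqrt n * (empCdf u n t - t)

/-- The uniform quantile process `β_n`. -/
def quantileProcess (u : ℕ → ℝ) (n : ℕ) (t : ℝ) : ℝ :=
  Real.sqrt n * (empQuantile u n t - t)

/-- The local empirical process `𝒟_{n,h,t}`. -/
def localEmp (u : ℕ → ℝ) (n : ℕ) (h t s : ℝ) : ℝ :=
  empProcess u n (t + h * s) - empProcess u n t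

/-- The local quantile process `𝒟'_{n,h,t}`. -/
def localQuantile (u : ℕ → ℝ) (n : ℕ) (h t s : ℝ) : ℝ :=
  quantileProcess u n (t + h * s) - quantileProcess u n t

/-- The sup norm over `[0,1]`, with value `∞` for an unbounded function. -/
def supNorm (g : ℝ → ℝ) : ℝ≥0∞ := ⨆ s ∈ Set.Icc (0 : ℝ) 1, ENNReal.ofReal |g s|

/-- `R_n(h)`, the sup norm of `𝒟_{n,h,0} + 𝒟'_{n,h,0}`. -/
def bkRemainder (u : ℕ → ℝ) (n : ℕ) (h : ℝ) : ℝ≥0∞ :=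
  supNorm (fun s => localEmp u n h 0 s + localQuantile u n h 0 s)

/-- `a_n(h) = (h log₂ n / n)^{1/2}`. -/
def aRate (n : ℕ) (h : ℝ) : ℝ := Real.sqrt (h * log₂ n / n)

/-- `d_n(h) = 2 log₂ n + log (n h)`. -/
def dRate (n : ℕ) (h : ℝ) : ℝ := 2 * log₂ n + Real.log (n * h)

/-- `r_n(h) = (a_n(h) d_n(h))^{1/2}`. -/
def rRate (n : ℕ) (h : ℝ) : ℝ := Real.sqrt (aRate n h * dRate n h)

/-- The local strong invariance conditions on a sequence `(h_n)_{n ≥ 1}` of positive constants: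
ultimately `h_n ↓ 0` and `n h_n ↑ ∞` (both in the weak sense), and `n h_n / log₂ n → ∞`. -/
structure LocalStrongInvariance (h : ℕ → ℝ) : Prop where
  pos : ∀ n : ℕ, 1 ≤ n → 0 < h n
  eventually_antitone : ∃ N : ℕ, AntitoneOn h (Set.Ici N)
  tendsto_zero : Tendsto h atTop (𝓝 0)
  eventually_monotone : ∃ N : ℕ, MonotoneOn (fun n : ℕ => (n : ℝ) * h n) (Set.Ici N)
  tendsto_mul : Tendsto (fun n : ℕ => (n : ℝ) * h n) atTop atTop
  tendsto_div : Tendsto (fun n : ℕ => (n : ℝ) * h n / log₂ n) atTop atTop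

end

end TailEmpirical

/-! Write `c(t) = n(F_n(t) - t)` and let `q` be the empirical quantile at `t`. Up to a limiting
argument at jumps, `c(q) = n(t - q)`, so `c(t) + n(q - t)` is the increment `c(t) - c(q)`. If `|c| <
n b` on the range in question, then `q` lies within `b` of `t`, and the remainder is at most the
modulus of `c` over windows of length `b`. This part is deterministic
(`abs_centeredCount_add_quantile_le`).

The probabilistic part is a modulus inequality with sharp constant, simultaneous in `n ≤ N`
(`exists_measure_modulus_le`). Doob's inequality gives Bernstein bounds for fixed intervals, a fine
grid keeps the constant near 1, and dyadic chaining controls the error inside grid cells. It is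
applied on blocks `n ≤ θ^k` and at scales `M = θ^i`, that is on `[0, M/θ^k]`. With `L = log k`, the
supremum of `|c|` is below `2θ√(ML)` and the modulus over windows with `θ^k b = 2θ²√(ML)` is below
`θ√(θ^k b (2L + log M))`. Both failure probabilities are summable over the scales `i ≤ k` and over
`k`, so Borel-Cantelli makes the bounds hold at all admissible scales at once; hence the uniformity
in `h`.

For `n` in a block and `M` comparable to `nh`, `√(ML)` is about `n a_n(h)` and `2L + log M` about
`d_n(h)`. The squared modulus divided by `n` is then about `2 a_n(h) d_n(h)`. Letting `θ` decrease
to 1 gives the constant `√2`. -/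

namespace TailEmpirical

/-! ### Exponential maximal inequality -/

section Maximal

variable {Ω : Type*} [MeasurableSpace Ω] {P : Measure Ω}

/-- Doob's maximal inequality for the exponential submartingale of a sum of independent bounded
variables. -/
theorem measure_exists_le_sum_le [IsProbabilityMeasure P] {Y : ℕ → Ω → ℝ} {B c : ℝ}
    (hY : ∀ i, Measurable (Y i)) (hind : iIndepFun Y P) (hB : ∀ i ω, |Y i ω| ≤ B)
    (h1 : ∀ i, 1 ≤ ∫ ω, Real.exp (Y i ω) ∂P) (h2 : ∀ i, ∫ ω, Real.exp (Y i ω) ∂P ≤ Real.exp c)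
    (x : ℝ) (N : ℕ) :
    P {ω | ∃ n < N, x ≤ ∑ i ∈ Finset.range (n + 1), Y i ω} ≤
      ENNReal.ofReal (Real.exp (-x + N * c)) := by
  rcases N with _ | N
  · simp
  set M : ℕ → Ω → ℝ := fun n ω => Real.exp (∑ i ∈ Finset.range (n + 1), Y i ω) with hM
  have hMm : ∀ n, Measurable (M n) := fun n =>
    Real.measurable_exp.comp (Finset.measurable_sum _ fun i _ => hY i)
  have hYs : ∀ i, StronglyMeasurable (Y i) := fun i => (hY i).stronglyMeasurable
  let 𝒢 := Filtration.natural Y hYs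
  have hbd : ∀ n ω, ‖M n ω‖ ≤ Real.exp ((n + 1) * B) := by
    intro n ω
    rw [Real.norm_eq_abs, abs_of_pos (Real.exp_pos _)]
    apply Real.exp_le_exp.2
    calc ∑ i ∈ Finset.range (n + 1), Y i ω ≤ ∑ i ∈ Finset.range (n + 1), B :=
          Finset.sum_le_sum fun i _ => (le_abs_self _).trans (hB i ω)
      _ = (n + 1) * B := by simp
  have hint : ∀ n, Integrable (M n) P := fun n =>
    Integrable.of_bound (hMm n).aestronglyMeasurable _ (ae_of_all _ (hbd n))
  have hZint : ∀ n, Integrable (fun ω => Real.exp (Y n ω)) P := fun n =>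
    Integrable.of_bound (Real.measurable_exp.comp (hY n)).aestronglyMeasurable (Real.exp B)
      (ae_of_all _ fun ω => by
        rw [Real.norm_eq_abs, abs_of_pos (Real.exp_pos _)]
        exact Real.exp_le_exp.2 ((le_abs_self _).trans (hB n ω)))
  have hadp : StronglyAdapted 𝒢 M := by
    intro n
    apply Real.continuous_exp.comp_stronglyMeasurable
    refine Finset.stronglyMeasurable_fun_sum _ fun i hi => ?_
    exact ((Filtration.stronglyAdapted_natural hYs) i).mono
      (𝒢.mono (Nat.lt_succ_iff.1 (Finset.mem_range.1 hi)))
  have hsucc : ∀ n, M (n + 1) = M n * (fun ω => Real.exp (Y (n + 1) ω)) := by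
    intro n
    funext ω
    simp only [hM, Pi.mul_apply]
    rw [Finset.sum_range_succ _ (n + 1), Real.exp_add]
  -- The factors need not have mean one: a mean at least 1 suffices for the submartingale property,
  -- and the bound `exp c` enters only through the terminal expectation.
  have hsub : Submartingale M 𝒢 P := by
    refine submartingale_nat hadp hint fun n => ?_
    have e1 : P[M (n + 1) | 𝒢 n] =ᵐ[P] M n * P[fun ω => Real.exp (Y (n + 1) ω) | 𝒢 n] := by
      rw [hsucc]
      exact condExp_mul_of_stronglyMeasurable_left (hadp n) (hsucc n ▸ hint (n + 1)) (hZint _)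
    have e2 : P[fun ω => Real.exp (Y (n + 1) ω) | 𝒢 n] =ᵐ[P]
        fun _ => ∫ ω, Real.exp (Y (n + 1) ω) ∂P := by
      have hle : MeasurableSpace.comap (Y (n + 1)) inferInstance ≤ ‹MeasurableSpace Ω› :=
        (hY (n + 1)).comap_le
      refine condExp_indep_eq hle (𝒢.le n) ?_ (hind.indep_comap_natural_of_lt hYs n.lt_succ_self)
      exact Real.continuous_exp.comp_stronglyMeasurable
        (comap_measurable (Y (n + 1))).stronglyMeasurable
    filter_upwards [e1, e2] with ω w1 w2
    rw [w1, Pi.mul_apply, w2]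
    exact le_mul_of_one_le_right (Real.exp_pos _).le (h1 _)
  have hmax := maximal_ineq hsub (fun n ω => (Real.exp_pos _).le)
    (ε := ⟨Real.exp x, (Real.exp_pos _).le⟩) N
  set A := {ω | Real.exp x ≤
    (Finset.range (N + 1)).sup' Finset.nonempty_range_add_one fun k => M k ω} with hA
  have hAs : {ω | ∃ n < N + 1, x ≤ ∑ i ∈ Finset.range (n + 1), Y i ω} ⊆ A := by
    rintro ω ⟨n, hn, hx⟩
    simp only [hA, Set.mem_ofPred_eq, Finset.le_sup'_iff]
    exact ⟨n, Finset.mem_range.2 hn, Real.exp_le_exp.2 hx⟩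
  have hEM : ∫ ω, M N ω ∂P ≤ Real.exp ((N + 1 : ℕ) * c) := by
    have e : ∫ ω, M N ω ∂P = mgf (∑ i ∈ Finset.range (N + 1), Y i) P 1 := by
      simp [mgf, hM]
    rw [e, hind.mgf_sum hY]
    calc ∏ i ∈ Finset.range (N + 1), mgf (Y i) P 1 ≤ ∏ i ∈ Finset.range (N + 1), Real.exp c :=
          Finset.prod_le_prod (fun i _ => mgf_nonneg) fun i _ => by simpa [mgf] using h2 i
      _ = Real.exp ((N + 1 : ℕ) * c) := by
          rw [Finset.prod_const, Finset.card_range, ← Real.exp_nat_mul]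
  have hAint : ∫ ω in A, M N ω ∂P ≤ Real.exp ((N + 1 : ℕ) * c) :=
    (setIntegral_le_integral (hint N) (ae_of_all _ fun ω => (Real.exp_pos _).le)).trans hEM
  have hmax' : ENNReal.ofReal (Real.exp x) * P A ≤ ENNReal.ofReal (Real.exp ((N + 1 : ℕ) * c)) := by
    refine le_trans (le_of_eq ?_) (hmax.trans (ENNReal.ofReal_le_ofReal hAint))
    congr 1
    exact ENNReal.ofReal_eq_coe_nnreal _
  calc P _ ≤ P A := measure_mono hAs
    _ = ENNReal.ofReal (Real.exp (-x)) * (ENNReal.ofReal (Real.exp x) * P A) := by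
        rw [← mul_assoc, ← ENNReal.ofReal_mul (Real.exp_pos _).le, ← Real.exp_add]; simp
    _ ≤ ENNReal.ofReal (Real.exp (-x)) * ENNReal.ofReal (Real.exp ((N + 1 : ℕ) * c)) := by gcongr
    _ = _ := by rw [← ENNReal.ofReal_mul (Real.exp_pos _).le, ← Real.exp_add]

/-- The difference of the two sides has derivative at least `1 - (1 - y) exp y ≥ 0`. Keeping the
factor `exp x` makes the bound asymptotic to `x²/2` as `x → 0`, which the sharp constant needs. -/
theorem exp_sub_one_sub_le {x : ℝ} (hx : 0 ≤ x) :
    Real.exp x - 1 - x ≤ x ^ 2 / 2 * Real.exp x := by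
  have hmono : MonotoneOn (fun y : ℝ => y ^ 2 / 2 * Real.exp y - (Real.exp y - 1 - y))
      (Set.Ici 0) := by
    have hd : ∀ y : ℝ, HasDerivAt (fun y : ℝ => y ^ 2 / 2 * Real.exp y - (Real.exp y - 1 - y))
        ((y * Real.exp y + y ^ 2 / 2 * Real.exp y) - (Real.exp y - 1)) y := by
      intro y
      have h1 := (((hasDerivAt_pow 2 y).div_const 2).mul (Real.hasDerivAt_exp y)).sub
        (((Real.hasDerivAt_exp y).sub_const 1).sub (hasDerivAt_id y))
      exact h1.congr_deriv (by norm_num)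
    refine monotoneOn_of_deriv_nonneg (convex_Ici 0)
      (fun y _ => (hd y).continuousAt.continuousWithinAt)
      (fun y _ => (hd y).differentiableAt.differentiableWithinAt) fun y hy => ?_
    rw [interior_Ici, Set.mem_Ioi] at hy
    rw [(hd y).deriv]
    have h3 : 1 - y ≤ Real.exp (-y) := by linarith [Real.add_one_le_exp (-y)]
    have h4 : (1 - y) * Real.exp y ≤ 1 := by
      calc (1 - y) * Real.exp y ≤ Real.exp (-y) * Real.exp y := by
            gcongr
        _ = 1 := by rw [← Real.exp_add]; simp
    have h5 : 0 ≤ y ^ 2 / 2 * Real.exp y := by positivity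
    linarith
  have := hmono (Set.mem_Ici.2 le_rfl) (Set.mem_Ici.2 hx) hx
  simp at this
  linarith

/-- Reduces to the previous bound through `x ≤ sinh x`, so that upper and lower tails share one
majorant. -/
theorem exp_neg_sub_le {x : ℝ} (hx : 0 ≤ x) :
    Real.exp (-x) - 1 + x ≤ x ^ 2 / 2 * Real.exp x := by
  have h1 : Real.exp (-x) ≤ 1 := Real.exp_le_one_iff.2 (by linarith)
  have h2 : 1 + x + x ^ 2 / 2 ≤ Real.exp x := Real.quadratic_le_exp_of_nonneg hx
  have h3 := exp_sub_one_sub_le hx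
  have h4 : Real.exp (-x) * Real.exp x = 1 := by rw [← Real.exp_add]; simp
  have h5 : Real.exp (-x) + x ≤ Real.exp x - x := by
    have h6 : MonotoneOn (fun y : ℝ => Real.sinh y - y) (Set.Ici 0) := by
      exact Real.sinh_sub_id_strictMono.monotone.monotoneOn _
    have := h6 (Set.mem_Ici.2 le_rfl) (Set.mem_Ici.2 hx) hx
    simp [Real.sinh_eq] at this
    linarith
  linarith

end Maximal

/-! ### Centred counts of a uniform sample and their tail bounds -/

/-- `n (F_n(t) - t)`, the centred number of sample points in `(-∞, t]`. -/
noncomputable def centeredCount (u : ℕ → ℝ) (n : ℕ) (t : ℝ) : ℝ :=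
  (((Finset.range n).filter (fun i => u i ≤ t)).card : ℝ) - n * t

/-- The centred number of sample points in `(s, t]`. -/
noncomputable def countIncr (u : ℕ → ℝ) (n : ℕ) (s t : ℝ) : ℝ :=
  centeredCount u n t - centeredCount u n s

theorem countIncr_eq_sum (u : ℕ → ℝ) (n : ℕ) {s t : ℝ} (hst : s ≤ t) :
    countIncr u n s t =
      ∑ i ∈ Finset.range n, ((Set.Ioc s t).indicator (fun _ => (1 : ℝ)) (u i) - (t - s)) := by
  have h : ∀ r : ℝ, (((Finset.range n).filter (fun i => u i ≤ r)).card : ℝ) =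
      ∑ i ∈ Finset.range n, if u i ≤ r then (1 : ℝ) else 0 := by
    intro r; simp
  have h2 : ∀ i, (Set.Ioc s t).indicator (fun _ => (1 : ℝ)) (u i) =
      (if u i ≤ t then (1 : ℝ) else 0) - if u i ≤ s then (1 : ℝ) else 0 := by
    intro i
    by_cases h1 : u i ≤ s
    · have h3 : u i ≤ t := h1.trans hst
      simp [h1, h3, not_lt.2 h1]
    · by_cases h3 : u i ≤ t <;> simp [h1, h3, not_le.1 h1]
  simp only [countIncr, centeredCount, h, h2, Finset.sum_sub_distrib, Finset.sum_const,
    Finset.card_range, nsmul_eq_mul]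
  ring

/-- Monotonicity of the uncentred counts. -/
theorem neg_le_countIncr (u : ℕ → ℝ) (n : ℕ) {s t : ℝ} (hst : s ≤ t) :
    -(n * (t - s)) ≤ countIncr u n s t := by
  rw [countIncr_eq_sum u n hst, Finset.sum_sub_distrib]
  have : 0 ≤ ∑ i ∈ Finset.range n, (Set.Ioc s t).indicator (fun _ => (1 : ℝ)) (u i) :=
    Finset.sum_nonneg fun i _ => Set.indicator_nonneg (fun _ _ => zero_le_one) _
  simp only [Finset.sum_const, Finset.card_range, nsmul_eq_mul]
  linarith

/-- An independent sample from the uniform distribution on `[0, 1]`. -/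
structure IsUniformSample {Ω : Type*} [MeasurableSpace Ω] (P : Measure Ω) (U : ℕ → Ω → ℝ) :
    Prop where
  measurable : ∀ i, Measurable (U i)
  indep : iIndepFun U P
  unif : ∀ i, pdf.IsUniform (U i) (Set.Icc 0 1) P volume

section Sample

variable {Ω : Type*} [MeasurableSpace Ω] {P : Measure Ω} {U : ℕ → Ω → ℝ}

theorem IsUniformSample.measureReal_preimage_Ioc (hU : IsUniformSample P U) (i : ℕ) {s t : ℝ}
    (hs : 0 ≤ s) (hst : s ≤ t) (ht : t ≤ 1) : P.real (U i ⁻¹' Set.Ioc s t) = t - s := by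
  rw [measureReal_def, (hU.unif i).measure_preimage (by simp) (by simp) measurableSet_Ioc]
  have : Set.Icc (0 : ℝ) 1 ∩ Set.Ioc s t = Set.Ioc s t :=
    Set.inter_eq_right.2 fun x hx => ⟨hs.trans hx.1.le, hx.2.trans ht⟩
  rw [this]
  simp [hst]

theorem IsUniformSample.ae_pos (hU : IsUniformSample P U) : ∀ᵐ ω ∂P, ∀ i, 0 < U i ω := by
  rw [ae_all_iff]
  intro i
  have h : P (U i ⁻¹' Set.Iic 0) = 0 := by
    rw [(hU.unif i).measure_preimage (by simp) (by simp) measurableSet_Iic]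
    have : Set.Icc (0 : ℝ) 1 ∩ Set.Iic 0 = {0} := by
      ext x; simp only [Set.mem_inter_iff, Set.mem_Icc, Set.mem_Iic, Set.mem_singleton_iff]
      constructor
      · rintro ⟨⟨h1, -⟩, h2⟩; linarith
      · rintro rfl; norm_num
    simp [this]
  rw [ae_iff]
  convert h using 2
  ext ω; simp

variable [IsProbabilityMeasure P]

theorem IsUniformSample.integral_exp (hU : IsUniformSample P U) (i : ℕ) {s t : ℝ}
    (hs : 0 ≤ s) (hst : s ≤ t) (ht : t ≤ 1) (a : ℝ) :
    ∫ ω, Real.exp (a * ((Set.Ioc s t).indicator (fun _ => (1 : ℝ)) (U i ω) - (t - s))) ∂P =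
      Real.exp (-(a * (t - s))) * (1 + (Real.exp a - 1) * (t - s)) := by
  have h : ∀ ω, Real.exp (a * ((Set.Ioc s t).indicator (fun _ => (1 : ℝ)) (U i ω) - (t - s))) =
      Real.exp (-(a * (t - s))) *
        (1 + (U i ⁻¹' Set.Ioc s t).indicator (fun _ => Real.exp a - 1) ω) := by
    intro ω
    by_cases hω : U i ω ∈ Set.Ioc s t
    · rw [Set.indicator_of_mem hω, Set.indicator_of_mem (by exact hω)]
      rw [show a * (1 - (t - s)) = -(a * (t - s)) + a by ring, Real.exp_add]; ring
    · rw [Set.indicator_of_notMem hω, Set.indicator_of_notMem (by exact hω)]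
      rw [show a * (0 - (t - s)) = -(a * (t - s)) by ring]; ring
  have hms : MeasurableSet (U i ⁻¹' Set.Ioc s t) := hU.measurable i measurableSet_Ioc
  simp_rw [h]
  rw [integral_const_mul, integral_add (integrable_const _)
    ((integrable_const _).indicator hms), integral_indicator_const _ hms,
    hU.measureReal_preimage_Ioc i hs hst ht]
  simp [mul_comm]

/-- With `p = t - s`, the moment generating function of a centred Bernoulli variable is at most `exp
(p (exp a - 1 - a))`, and at least 1 by convexity. The sign of `a` is free, so one statement serves
both tails; `0 < x` excludes `n = 0`. -/
theorem IsUniformSample.measure_exists_le_mul_countIncr_le (hU : IsUniformSample P U) {s t : ℝ}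
    (hs : 0 ≤ s) (hst : s ≤ t) (ht : t ≤ 1) {a q : ℝ} (ha : Real.exp a - 1 - a ≤ q) {v : ℝ}
    (hq : 0 ≤ q) {N : ℕ} (hv : N * (t - s) ≤ v) {x : ℝ} (hx : 0 < x) :
    P {ω | ∃ n ≤ N, x ≤ a * countIncr (fun i => U i ω) n s t} ≤
      ENNReal.ofReal (Real.exp (-x + v * q)) := by
  set Y : ℕ → Ω → ℝ := fun i ω =>
    a * ((Set.Ioc s t).indicator (fun _ => (1 : ℝ)) (U i ω) - (t - s)) with hYdef
  have hg : Measurable fun y : ℝ => a * ((Set.Ioc s t).indicator (fun _ => (1 : ℝ)) y - (t - s)) :=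
    ((measurable_const.indicator measurableSet_Ioc).sub_const _).const_mul _
  have hY : ∀ i, Measurable (Y i) := fun i => hg.comp (hU.measurable i)
  have hind : iIndepFun Y P := hU.indep.comp _ fun _ => hg
  have hB : ∀ i ω, |Y i ω| ≤ |a| * 1 := by
    intro i ω
    rw [hYdef, abs_mul]
    gcongr
    by_cases hω : U i ω ∈ Set.Ioc s t
    · rw [Set.indicator_of_mem hω, abs_le]; constructor <;> linarith
    · rw [Set.indicator_of_notMem hω, abs_le]; constructor <;> linarith
  have hst0 : 0 ≤ t - s := by linarith
  have h1 : ∀ i, 1 ≤ ∫ ω, Real.exp (Y i ω) ∂P := by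
    intro i
    rw [hU.integral_exp i hs hst ht]
    have hc := (convexOn_exp).2 (Set.mem_univ (0 : ℝ)) (Set.mem_univ a)
      (show 0 ≤ 1 - (t - s) by linarith) hst0 (by ring)
    simp only [smul_eq_mul, mul_zero, zero_add, Real.exp_zero, mul_one] at hc
    calc (1 : ℝ) = Real.exp (-(a * (t - s))) * Real.exp ((t - s) * a) := by
          rw [← Real.exp_add]; ring_nf; simp
      _ ≤ _ := by gcongr; linarith
  have h2 : ∀ i, ∫ ω, Real.exp (Y i ω) ∂P ≤ Real.exp ((t - s) * q) := by
    intro i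
    rw [hU.integral_exp i hs hst ht]
    calc _ ≤ Real.exp (-(a * (t - s))) * Real.exp ((Real.exp a - 1) * (t - s)) := by
          gcongr; linarith [Real.add_one_le_exp ((Real.exp a - 1) * (t - s))]
      _ = Real.exp ((t - s) * (Real.exp a - 1 - a)) := by rw [← Real.exp_add]; ring_nf
      _ ≤ _ := by gcongr
  have := measure_exists_le_sum_le hY hind hB h1 h2 x N
  refine (measure_mono ?_).trans (this.trans (ENNReal.ofReal_le_ofReal ?_))
  · rintro ω ⟨n, hn, hxn⟩
    rw [countIncr_eq_sum _ _ hst] at hxn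
    rcases n with _ | n
    · simp at hxn; linarith
    · exact ⟨n, hn, by rw [← Finset.mul_sum]; exact hxn⟩
  · apply Real.exp_le_exp.2
    nlinarith

/-- A Bernstein-type maximal inequality for the empirical mass of a fixed interval. -/
theorem IsUniformSample.measure_exists_le_abs_countIncr_le (hU : IsUniformSample P U) {s t : ℝ}
    (hs : 0 ≤ s) (hst : s ≤ t) (ht : t ≤ 1) {a v : ℝ} (ha : 0 < a)
    {N : ℕ} (hv : N * (t - s) ≤ v) {x : ℝ} (hx : 0 < x) :
    P {ω | ∃ n ≤ N, x ≤ |countIncr (fun i => U i ω) n s t|} ≤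
      ENNReal.ofReal (2 * Real.exp (-(a * x) + v * (a ^ 2 / 2 * Real.exp a))) := by
  have h1 := hU.measure_exists_le_mul_countIncr_le hs hst ht (exp_sub_one_sub_le ha.le)
    (by positivity) hv (mul_pos ha hx)
  have h2 := hU.measure_exists_le_mul_countIncr_le hs hst ht (a := -a)
    (by linarith [exp_neg_sub_le ha.le]) (q := a ^ 2 / 2 * Real.exp a)
    (by positivity) hv (mul_pos ha hx)
  rw [two_mul, ENNReal.ofReal_add (by positivity) (by positivity)]
  refine le_trans (measure_mono ?_) ((measure_union_le _ _).trans (add_le_add h1 h2))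
  rintro ω ⟨n, hn, hxn⟩
  rcases le_abs.1 hxn with h | h
  · exact Or.inl ⟨n, hn, by gcongr⟩
  · exact Or.inr ⟨n, hn, by nlinarith⟩

end Sample

/-! ### Oscillation in a small cell by dyadic chaining -/

/-- Chaining along dyadic points. -/
theorem abs_sub_le_sum_of_dyadic {c : ℝ → ℝ} {s ℓ : ℝ} {x : ℕ → ℝ} {m : ℕ}
    (hx : ∀ l, 0 ≤ x l)
    (h : ∀ l ≤ m, ∀ j < 2 ^ l, |c (s + (j + 1 : ℕ) * (ℓ / 2 ^ l)) - c (s + (j : ℕ) * (ℓ / 2 ^ l))| ≤ x l)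
    (l : ℕ) (hl : l ≤ m) (j : ℕ) (hj : j ≤ 2 ^ l) :
    |c (s + j * (ℓ / 2 ^ l)) - c s| ≤ ∑ i ∈ Finset.range (l + 1), x i := by
  induction l generalizing j with
  | zero =>
    rcases Nat.le_one_iff_eq_zero_or_eq_one.1 (by simpa using hj) with rfl | rfl
    · simpa using hx 0
    · simpa using h 0 hl 0 (by simp)
  | succ l ih =>
    have heven : ∀ i : ℕ, (s + (2 * i : ℕ) * (ℓ / 2 ^ (l + 1)) : ℝ) = s + i * (ℓ / 2 ^ l) := by
      intro i; push_cast; rw [pow_succ]; field_simp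
    rw [pow_succ] at hj
    rcases Nat.even_or_odd' j with ⟨i, rfl | rfl⟩
    · rw [heven, Finset.sum_range_succ]
      exact (ih (by omega) i (by omega)).trans (le_add_of_nonneg_right (hx _))
    · have h1 := h (l + 1) hl (2 * i) (by rw [pow_succ]; omega)
      rw [heven] at h1
      have h2 := ih (by omega) i (by omega)
      rw [Finset.sum_range_succ]
      calc _ ≤ _ := abs_sub_le _ (c (s + i * (ℓ / 2 ^ l))) _
        _ ≤ _ := by linarith

theorem sum_range_add_one_mul_pow (n : ℕ) :
    ∑ l ∈ Finset.range n, ((l : ℝ) + 1) * (3 / 4) ^ l = 16 - (16 + 4 * n) * (3 / 4) ^ n := by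
  induction n with
  | zero => simp
  | succ n ih => rw [Finset.sum_range_succ, ih]; push_cast; ring

section Sample

variable {Ω : Type*} [MeasurableSpace Ω] {P : Measure Ω} {U : ℕ → Ω → ℝ}
  [IsProbabilityMeasure P]

/-- The parameter is `a = √(z / v)` in the Gaussian range `z ≤ v`, and `a = 1` otherwise. In both
cases `a x ≥ 3z`, while the variance term is at most `3z/2` because `exp 1 ≤ 3`. -/
theorem IsUniformSample.measure_exists_le_abs_countIncr_le_exp_neg (hU : IsUniformSample P U)
    {s t : ℝ} (hs : 0 ≤ s) (hst : s ≤ t) (ht : t ≤ 1) {N : ℕ} {v x z : ℝ}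
    (hv : N * (t - s) ≤ v) (hv0 : 0 < v) (hz : 0 < z) (h1 : 3 * √(v * z) ≤ x) (h2 : 3 * z ≤ x) :
    P {ω | ∃ n ≤ N, x ≤ |countIncr (fun i => U i ω) n s t|} ≤
      ENNReal.ofReal (2 * Real.exp (-z)) := by
  have he : Real.exp 1 ≤ 3 := by linarith [Real.exp_one_lt_d9]
  rcases le_or_gt z v with hzv | hzv
  · have ha : 0 < √(z / v) := Real.sqrt_pos.2 (by positivity)
    refine (hU.measure_exists_le_abs_countIncr_le hs hst ht ha hv (by linarith)).trans
      (ENNReal.ofReal_le_ofReal ?_)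
    gcongr
    have e1 : √(z / v) ^ 2 = z / v := Real.sq_sqrt (by positivity)
    have e2 : √(z / v) ≤ 1 := Real.sqrt_le_one.2 ((div_le_one hv0).2 hzv)
    have e3 : √(z / v) * √(v * z) = z := by
      rw [← Real.sqrt_mul (by positivity), show z / v * (v * z) = z ^ 2 by field_simp,
        Real.sqrt_sq hz.le]
    have e4 : Real.exp √(z / v) ≤ 3 := (Real.exp_le_exp.2 e2).trans he
    have e5 : v * (√(z / v) ^ 2 / 2 * Real.exp √(z / v)) ≤ v * (z / v / 2 * 3) := by
      rw [e1]; gcongr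
    have e6 : v * (z / v / 2 * 3) = 3 / 2 * z := by field_simp
    have e7 : √(z / v) * (3 * √(v * z)) ≤ √(z / v) * x := by gcongr
    linarith
  · refine (hU.measure_exists_le_abs_countIncr_le hs hst ht one_pos hv (by linarith)).trans
      (ENNReal.ofReal_le_ofReal ?_)
    gcongr
    have : v * (1 ^ 2 / 2 * Real.exp 1) ≤ z * (1 ^ 2 / 2 * 3) := by gcongr
    linarith

/-- Union bound over the `2 ^ l` cells of each dyadic level; it converges because `2 / e < 4/5`. -/
theorem sum_two_pow_mul_exp_le {y : ℝ} (hy : 1 ≤ y) (m : ℕ) :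
    ∑ l ∈ Finset.range m, (2 : ℝ) ^ l * (2 * Real.exp (-(y * (l + 1)))) ≤ 10 * Real.exp (-y) := by
  have he : (2 : ℝ) * Real.exp (-1) ≤ 4 / 5 := by
    have h1 : Real.exp (-1) * Real.exp 1 = 1 := by rw [← Real.exp_add]; simp
    have h2 := Real.exp_one_gt_d9
    nlinarith [Real.exp_pos (-1)]
  calc ∑ l ∈ Finset.range m, (2 : ℝ) ^ l * (2 * Real.exp (-(y * (l + 1))))
      ≤ ∑ l ∈ Finset.range m, 2 * Real.exp (-y) * (4 / 5) ^ l := by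
        refine Finset.sum_le_sum fun l _ => ?_
        calc (2 : ℝ) ^ l * (2 * Real.exp (-(y * (l + 1))))
            ≤ (2 : ℝ) ^ l * (2 * (Real.exp (-y) * Real.exp (-1) ^ l)) := by
              rw [← Real.exp_nat_mul, ← Real.exp_add]
              gcongr
              nlinarith [(Nat.cast_nonneg l : (0 : ℝ) ≤ l)]
          _ = 2 * Real.exp (-y) * (2 * Real.exp (-1)) ^ l := by rw [mul_pow]; ring
          _ ≤ _ := by gcongr
    _ = 2 * Real.exp (-y) * ∑ l ∈ Finset.range m, (4 / 5 : ℝ) ^ l := by rw [Finset.mul_sum]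
    _ ≤ 2 * Real.exp (-y) * 5 := by
        gcongr
        have := geom_sum_Ico_le_of_lt_one (m := 0) (n := m) (show (0 : ℝ) ≤ 4 / 5 by norm_num)
          (by norm_num)
        norm_num at this
        simpa using this
    _ = _ := by ring

/-- Oscillation of the empirical process over a small cell, with a crude constant. -/
theorem IsUniformSample.measure_exists_osc_le (hU : IsUniformSample P U) {s ℓ V y : ℝ} {N : ℕ}
    (hs : 0 ≤ s) (hℓ : 0 < ℓ) (hsℓ : s + ℓ ≤ 1) (hNV : N ≤ V) (hy : 1 ≤ y) (hyV : y ≤ V * ℓ) :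
    P {ω | ∃ n ≤ N, ∃ t ∈ Set.Icc s (s + ℓ),
        100 * √(V * ℓ * y) ≤ |countIncr (fun i => U i ω) n s t|} ≤
      ENNReal.ofReal (10 * Real.exp (-y)) := by
  have hy0 : 0 < y := by linarith
  have hVℓ : 0 < V * ℓ := by linarith
  have hV : 0 < V := pos_of_mul_pos_left hVℓ hℓ.le
  -- The depth balances two needs: `y 2^m ≤ A` keeps the linear condition of the tail bound valid at
  -- every level, and `V ℓ / 2^m ≤ 2A` makes the finest cells negligible.
  obtain ⟨m, hm1, hm2⟩ := exists_nat_pow_near (x := V * ℓ / y) (y := 4)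
    ((one_le_div hy0).2 hyV) (by norm_num)
  rw [le_div_iff₀ hy0] at hm1
  rw [div_lt_iff₀ hy0] at hm2
  set A := √(V * ℓ * y) with hA
  have hA0 : 0 < A := Real.sqrt_pos.2 (by positivity)
  have hA2 : A ^ 2 = V * ℓ * y := Real.sq_sqrt (by positivity)
  have hyA : y * 2 ^ m ≤ A := by
    apply Real.le_sqrt_of_sq_le
    calc (y * 2 ^ m) ^ 2 = y * (4 ^ m * y) := by
          rw [mul_pow, ← pow_mul, mul_comm m 2, pow_mul]; norm_num; ring
      _ ≤ y * (V * ℓ) := by gcongr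
      _ = _ := by ring
  have hend : V * (ℓ / 2 ^ m) ≤ 2 * A := by
    apply (pow_le_pow_iff_left₀ (by positivity) (by positivity) two_ne_zero).1
    calc (V * (ℓ / 2 ^ m)) ^ 2 = V * ℓ * (V * ℓ) / 4 ^ m := by
          rw [show (4 : ℝ) = 2 ^ 2 by norm_num, ← pow_mul, mul_comm 2 m, pow_mul]; field_simp
      _ ≤ V * ℓ * (4 ^ (m + 1) * y) / 4 ^ m := by gcongr
      _ = (2 * A) ^ 2 := by rw [mul_pow, hA2, pow_succ]; field_simp; ring
  -- At level `l` the variance falls by `2^l` and the exponent grows to `y (l + 1)`. Since `1/2 ≤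
  -- (3/4)²`, the weight `(l + 1)(3/4)^l` dominates the resulting square root. The weights sum to
  -- less than 16, so the chain costs at most `96 A`.
  let x : ℕ → ℝ := fun l => 6 * A * ((l + 1) * (3 / 4) ^ l)
  have hx0 : ∀ l, 0 ≤ x l := fun l => by positivity
  let bad : ℕ → ℕ → Set Ω := fun l j => {ω | ∃ n ≤ N, x l ≤
    |countIncr (fun i => U i ω) n (s + (j : ℕ) * (ℓ / 2 ^ l)) (s + (j + 1 : ℕ) * (ℓ / 2 ^ l))|}
  have hbad : ∀ l ≤ m, ∀ j < 2 ^ l, P (bad l j) ≤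
      ENNReal.ofReal (2 * Real.exp (-(y * (l + 1)))) := by
    intro l hl j hj
    have hj' : ((j + 1 : ℕ) : ℝ) ≤ 2 ^ l := by exact_mod_cast hj
    have hp : (0 : ℝ) < ℓ / 2 ^ l := by positivity
    have hend1 : s + (j + 1 : ℕ) * (ℓ / 2 ^ l) ≤ 1 := by
      calc s + (j + 1 : ℕ) * (ℓ / 2 ^ l) ≤ s + 2 ^ l * (ℓ / 2 ^ l) := by gcongr
        _ = s + ℓ := by field_simp
        _ ≤ 1 := hsℓ
    refine hU.measure_exists_le_abs_countIncr_le_exp_neg (v := V * (ℓ / 2 ^ l))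
      (by positivity) ?_ hend1 ?_ (by positivity) (by positivity) ?_ ?_
    · push_cast; linarith
    · push_cast
      rw [show s + (↑j + 1) * (ℓ / 2 ^ l) - (s + ↑j * (ℓ / 2 ^ l)) = ℓ / 2 ^ l by ring]
      gcongr
    · have : √(V * (ℓ / 2 ^ l) * (y * (l + 1))) ≤ A * ((l + 1) * (3 / 4) ^ l) := by
        apply Real.sqrt_le_iff.2 ⟨by positivity, ?_⟩
        rw [mul_pow, hA2, mul_pow, ← pow_mul, mul_comm l 2, pow_mul]
        calc V * (ℓ / 2 ^ l) * (y * (l + 1)) = V * ℓ * y * ((l + 1) * (1 / 2) ^ l) := by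
              rw [div_pow, one_pow]; ring
          _ ≤ V * ℓ * y * ((l + 1) ^ 2 * ((3 / 4) ^ 2) ^ l) := by
              gcongr
              · nlinarith [(Nat.cast_nonneg l : (0 : ℝ) ≤ l)]
              · norm_num
      have h0 : 0 ≤ A * ((l + 1) * (3 / 4 : ℝ) ^ l) := by positivity
      change _ ≤ 6 * A * ((l + 1) * (3 / 4) ^ l)
      linarith
    · have : y ≤ A * (3 / 4) ^ l := by
        calc y = y * 2 ^ l * (1 / 2) ^ l := by
              rw [mul_assoc, ← mul_pow]; norm_num
          _ ≤ A * (3 / 4) ^ l := by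
              exact mul_le_mul ((mul_le_mul_of_nonneg_left
                (pow_le_pow_right₀ (by norm_num) hl) hy0.le).trans hyA)
                (pow_le_pow_left₀ (by norm_num) (by norm_num) l) (by positivity) hA0.le
      have h0 : 0 ≤ A * (3 / 4 : ℝ) ^ l * (l + 1) := by positivity
      change _ ≤ 6 * A * ((l + 1) * (3 / 4) ^ l)
      calc 3 * (y * (l + 1)) ≤ 3 * (A * (3 / 4) ^ l * (l + 1)) := by gcongr
        _ ≤ _ := by linarith
  have hsub : {ω | ∃ n ≤ N, ∃ t ∈ Set.Icc s (s + ℓ),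
      100 * A ≤ |countIncr (fun i => U i ω) n s t|} ⊆
      ⋃ l ∈ Finset.range (m + 1), ⋃ j ∈ Finset.range (2 ^ l), bad l j := by
    rintro ω ⟨n, hn, t, ht, hbig⟩
    by_contra hω
    simp only [Set.mem_iUnion, Finset.mem_range, not_exists, Nat.lt_succ_iff] at hω
    set u : ℕ → ℝ := fun i => U i ω with hu
    have hgood : ∀ l ≤ m, ∀ j < 2 ^ l, |centeredCount u n (s + (j + 1 : ℕ) * (ℓ / 2 ^ l)) -
        centeredCount u n (s + (j : ℕ) * (ℓ / 2 ^ l))| ≤ x l := by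
      intro l hl j hj
      by_contra hc
      exact hω l hl j hj ⟨n, hn, (not_le.1 hc).le⟩
    have hch := abs_sub_le_sum_of_dyadic hx0 hgood m le_rfl
    have hsum : ∑ i ∈ Finset.range (m + 1), x i ≤ 96 * A := by
      have h0 : 0 ≤ (16 + 4 * ((m + 1 : ℕ) : ℝ)) * (3 / 4 : ℝ) ^ (m + 1) := by positivity
      rw [← Finset.mul_sum, sum_range_add_one_mul_pow]
      nlinarith
    set p := ℓ / 2 ^ m with hp
    have hp0 : 0 < p := by positivity
    have hpm : (2 ^ m : ℕ) * p = ℓ := by rw [hp]; push_cast; field_simp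
    have hts : 0 ≤ (t - s) / p := div_nonneg (by linarith [ht.1]) hp0.le
    have hj1 : ⌊(t - s) / p⌋₊ * p ≤ t - s := (le_div_iff₀ hp0).1 (Nat.floor_le hts)
    have hj2 : t - s ≤ ⌈(t - s) / p⌉₊ * p := (div_le_iff₀ hp0).1 (Nat.le_ceil _)
    have hjc : ⌈(t - s) / p⌉₊ ≤ 2 ^ m := by
      apply Nat.ceil_le.2
      rw [div_le_iff₀ hp0, hpm]
      linarith [ht.2]
    have hjf : ⌊(t - s) / p⌋₊ ≤ 2 ^ m := (Nat.floor_le_ceil _).trans hjc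
    have hcf : (⌈(t - s) / p⌉₊ : ℝ) ≤ ⌊(t - s) / p⌋₊ + 1 := by
      exact_mod_cast Nat.ceil_le_floor_add_one _
    have hcf' : (⌈(t - s) / p⌉₊ : ℝ) * p ≤ ⌊(t - s) / p⌋₊ * p + p := by nlinarith
    have b1 := hch _ hjf
    have b2 := hch _ hjc
    rw [abs_le] at b1 b2
    -- Inside a finest cell only monotonicity of the raw count is available: the left grid point
    -- bounds `c(t)` from below and the right one from above, each at a cost `V p ≤ 2A`. Hence `98 A
    -- < 100 A` in total.
    have n1 := neg_le_countIncr u n (show s + ⌊(t - s) / p⌋₊ * p ≤ t by linarith)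
    have n2 := neg_le_countIncr u n (show t ≤ s + ⌈(t - s) / p⌉₊ * p by linarith)
    have hnV : (n : ℝ) ≤ V := le_trans (by exact_mod_cast hn) hNV
    have n3 : (n : ℝ) * (t - (s + ⌊(t - s) / p⌋₊ * p)) ≤ V * p := by
      gcongr <;> linarith
    have n4 : (n : ℝ) * (s + ⌈(t - s) / p⌉₊ * p - t) ≤ V * p := by
      gcongr <;> linarith
    have hlt : |countIncr u n s t| < 100 * A := by
      unfold countIncr at n1 n2 ⊢
      rw [abs_lt]
      constructor <;> linarith [b1.1, b1.2, b2.1, b2.2]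
    linarith
  calc P _ ≤ P (⋃ l ∈ Finset.range (m + 1), ⋃ j ∈ Finset.range (2 ^ l), bad l j) :=
        measure_mono hsub
    _ ≤ ∑ l ∈ Finset.range (m + 1), ∑ j ∈ Finset.range (2 ^ l), P (bad l j) :=
        (measure_biUnion_finset_le _ _).trans
          (Finset.sum_le_sum fun l _ => measure_biUnion_finset_le _ _)
    _ ≤ ∑ l ∈ Finset.range (m + 1), ∑ j ∈ Finset.range (2 ^ l),
          ENNReal.ofReal (2 * Real.exp (-(y * (l + 1)))) :=
        Finset.sum_le_sum fun l hl => Finset.sum_le_sum fun j hj =>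
          hbad l (Nat.lt_succ_iff.1 (Finset.mem_range.1 hl)) j (Finset.mem_range.1 hj)
    _ = ENNReal.ofReal (∑ l ∈ Finset.range (m + 1),
          (2 : ℝ) ^ l * (2 * Real.exp (-(y * (l + 1))))) := by
        rw [ENNReal.ofReal_sum_of_nonneg fun _ _ => by positivity]
        refine Finset.sum_congr rfl fun l _ => ?_
        rw [Finset.sum_const, Finset.card_range, nsmul_eq_mul,
          ENNReal.ofReal_mul (show (0 : ℝ) ≤ 2 ^ l by positivity), ENNReal.ofReal_pow (by norm_num)]
        simp
    _ ≤ _ := ENNReal.ofReal_le_ofReal (sum_two_pow_mul_exp_le hy _)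

end Sample

/-! ### Modulus of continuity with the sharp constant -/

theorem _root_.ENNReal.sum_range_const_ofReal {x : ℝ} (hx : 0 ≤ x) (n : ℕ) :
    ∑ _i ∈ Finset.range n, ENNReal.ofReal x = ENNReal.ofReal (n * x) := by
  rw [← ENNReal.ofReal_sum_of_nonneg fun _ _ => hx]
  simp

theorem exists_grid_cell {Q : ℕ} {ℓ x : ℝ} (hQ : 0 < Q) (hℓ : 0 < ℓ) (hx : 0 ≤ x)
    (hxQ : x ≤ Q * ℓ) : ∃ j < Q, j * ℓ ≤ x ∧ x ≤ j * ℓ + ℓ := by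
  have hceil : ⌈x / ℓ⌉₊ ≤ Q := Nat.ceil_le.2 ((div_le_iff₀ hℓ).2 hxQ)
  have h1 : x ≤ ⌈x / ℓ⌉₊ * ℓ := (div_le_iff₀ hℓ).1 (Nat.le_ceil _)
  rcases Nat.eq_zero_or_pos ⌈x / ℓ⌉₊ with h0 | h0
  · exact ⟨0, hQ, by simpa using hx, by rw [h0] at h1; push_cast at h1 ⊢; linarith⟩
  · refine ⟨⌈x / ℓ⌉₊ - 1, by omega, ?_, ?_⟩
    · have h2 : ⌈x / ℓ⌉₊ - 1 < ⌈x / ℓ⌉₊ := by omega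
      exact ((lt_div_iff₀ hℓ).1 (Nat.lt_ceil.1 h2)).le
    · have : ((⌈x / ℓ⌉₊ - 1 : ℕ) : ℝ) + 1 = ⌈x / ℓ⌉₊ := by
        exact_mod_cast Nat.sub_add_cancel h0
      rw [← this] at h1
      linarith

section Sample

variable {Ω : Type*} [MeasurableSpace Ω] {P : Measure Ω} {U : ℕ → Ω → ℝ}
  [IsProbabilityMeasure P]

set_option maxHeartbeats 1000000 in
/-- Modulus of continuity of the empirical process on `[0, H]`, with the sharp constant. -/
theorem IsUniformSample.exists_measure_modulus_le (hU : IsUniformSample P U) {θ : ℝ} (hθ : 1 < θ) :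
    ∃ C W : ℝ, 0 < C ∧ 0 < W ∧ ∀ (N : ℕ) (V b H D : ℝ), N ≤ V → 0 < b → b ≤ H → H ≤ 1 → 2 ≤ D →
      W * D ≤ V * b →
      P {ω | ∃ n ≤ N, ∃ s t : ℝ, 0 ≤ s ∧ s ≤ t ∧ t ≤ H ∧ t - s ≤ b ∧
        θ * √(V * b * D) ≤ |countIncr (fun i => U i ω) n s t|} ≤
      ENNReal.ofReal (C * (H / b) * Real.exp (-((1 + θ) / 2 * D / 2))) := by
  -- The level `σ` is spent on increments between grid points; the gap `θ - σ` absorbs the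
  -- oscillation at the two endpoints.
  obtain ⟨σ, hσ⟩ : ∃ σ, σ = (1 + θ) / 2 := ⟨_, rfl⟩
  have hσ1 : 1 < σ := by linarith
  have hσ0 : 0 < σ := by linarith
  have hθσ : 0 < θ - σ := by linarith
  -- Solves `σ² - σ² κ / 2 = σ / 2`, so the Bernstein exponent comes out as exactly `-σ D / 2`. Of
  -- the two factors `√κ`, one pays for `exp a` and one for lengthening the window by `1 + 1/m`.
  obtain ⟨κ, hκ⟩ : ∃ κ, κ = 2 - 1 / σ := ⟨_, rfl⟩
  have hκ1 : 1 < κ := by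
    have : 1 / σ < 1 := (div_lt_one hσ0).2 hσ1
    linarith
  obtain ⟨r, hr⟩ : ∃ r, r = √κ := ⟨_, rfl⟩
  have hr1 : 1 < r := by rw [hr]; exact Real.lt_sqrt_of_sq_lt (by linarith)
  have hr2 : r * r = κ := by rw [hr]; exact Real.mul_self_sqrt (by linarith)
  have hlr : 0 < Real.log r := Real.log_pos hr1
  -- Grid cells have length at most `b / m`. The number `20000 σ = 200² σ / 2` comes from two
  -- oscillations with constant 100.
  obtain ⟨m, hm⟩ := exists_nat_ge (max 1 (max (1 / (r - 1)) (20000 * σ / (θ - σ) ^ 2)))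
  have hm1 : (1 : ℝ) ≤ m := (le_max_left _ _).trans hm
  have hm2 : 1 / (r - 1) ≤ m := (le_max_left _ _).trans ((le_max_right _ _).trans hm)
  have hm3 : 20000 * σ / (θ - σ) ^ 2 ≤ m := (le_max_right _ _).trans ((le_max_right _ _).trans hm)
  have hm0 : (0 : ℝ) < m := by linarith
  have hmr : 1 + 1 / (m : ℝ) ≤ r := by
    have : 1 / (m : ℝ) ≤ r - 1 := by
      rw [div_le_iff₀ (by linarith)] at hm2
      rw [div_le_iff₀ hm0]; linarith
    linarith
  -- There are at most `2 H m / b` cells; each contributes `2m + 2` grid increments of probability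
  -- `2 exp (-y)` and one oscillation of probability `10 exp (-y)`. In `W`, the first entry gives `y
  -- ≤ V ℓ` and the second `exp a ≤ r`.
  refine ⟨2 * m * (4 * m + 14), max (m * σ) (σ ^ 2 / (Real.log r) ^ 2), by positivity,
    by positivity, ?_⟩
  rw [← hσ]
  intro N V b H D hNV hb hbH hH hD hWD
  have hD0 : 0 < D := by linarith
  have hH0 : 0 < H := by linarith
  have hWD1 : m * σ * D ≤ V * b := le_trans (by gcongr; exact le_max_left _ _) hWD
  have hWD2 : σ ^ 2 / (Real.log r) ^ 2 * D ≤ V * b :=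
    le_trans (by gcongr; exact le_max_right _ _) hWD
  have hVb : 0 < V * b := lt_of_lt_of_le (by positivity) hWD1
  have hV : 0 < V := pos_of_mul_pos_left hVb hb.le
  set A := √(V * b * D) with hA
  have hA0 : 0 < A := Real.sqrt_pos.2 (by positivity)
  have hA2 : A ^ 2 = V * b * D := Real.sq_sqrt (by positivity)
  set y := σ * D / 2 with hy
  have hy1 : 1 ≤ y := by rw [hy]; nlinarith
  have hHmb : 1 ≤ H * m / b := (one_le_div hb).2 (by nlinarith)
  set Q := ⌈H * m / b⌉₊ with hQ
  have hQ1 : H * m / b ≤ Q := Nat.le_ceil _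
  have hQ2 : (Q : ℝ) ≤ 2 * (H * m / b) := by
    have := Nat.ceil_lt_add_one (show 0 ≤ H * m / b by positivity)
    linarith
  have hQ0 : (0 : ℝ) < Q := by linarith
  have hQpos : 0 < Q := by exact_mod_cast hQ0
  set ℓ := H / Q with hℓ
  have hℓ0 : 0 < ℓ := by positivity
  have hQℓ : Q * ℓ = H := by rw [hℓ]; field_simp
  have hℓ1 : ℓ ≤ b / m := by
    rw [hℓ, div_le_div_iff₀ hQ0 hm0]
    rw [div_le_iff₀ hb] at hQ1
    linarith
  have hℓ2 : b / (2 * m) ≤ ℓ := by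
    rw [hℓ, div_le_div_iff₀ (by positivity) hQ0]
    calc b * Q ≤ b * (2 * (H * m / b)) := by gcongr
      _ = H * (2 * m) := by field_simp
  have hyV : y ≤ V * ℓ := by
    calc y ≤ V * b / (2 * m) := by
          rw [hy, le_div_iff₀ (by positivity)]; linarith
      _ = V * (b / (2 * m)) := by ring
      _ ≤ V * ℓ := by gcongr
  have hosc : 200 * √(V * ℓ * y) ≤ (θ - σ) * A := by
    apply (pow_le_pow_iff_left₀ (by positivity) (by positivity) two_ne_zero).1
    rw [mul_pow, mul_pow, hA2, Real.sq_sqrt (by positivity)]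
    rw [div_le_iff₀ (by positivity)] at hm3
    calc 200 ^ 2 * (V * ℓ * y) ≤ 200 ^ 2 * (V * (b / m) * y) := by gcongr
      _ = 20000 * σ * (V * b * D) / m := by rw [hy]; ring
      _ ≤ m * (θ - σ) ^ 2 * (V * b * D) / m := by gcongr
      _ = _ := by field_simp
  -- the exponent of the Bernstein bound
  set a := σ * √(D / (V * b)) with ha
  have hs0 : 0 < √(D / (V * b)) := Real.sqrt_pos.2 (by positivity)
  have ha0 : 0 < a := by positivity
  have haA : a * (σ * A) = σ ^ 2 * D := by
    have : √(D / (V * b)) * A = D := by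
      rw [hA, ← Real.sqrt_mul (by positivity), show D / (V * b) * (V * b * D) = D ^ 2 by field_simp,
        Real.sqrt_sq hD0.le]
    rw [ha]
    calc _ = σ ^ 2 * (√(D / (V * b)) * A) := by ring
      _ = _ := by rw [this]
  have ha2 : a ^ 2 = σ ^ 2 * (D / (V * b)) := by
    rw [ha, mul_pow, Real.sq_sqrt (by positivity)]
  have har : Real.exp a ≤ r := by
    rw [← Real.exp_log (show 0 < r by linarith)]
    apply Real.exp_le_exp.2
    apply (pow_le_pow_iff_left₀ (by positivity) (by positivity) two_ne_zero).1
    rw [ha2]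
    have : σ ^ 2 * D ≤ V * b * Real.log r ^ 2 := by
      rw [div_mul_eq_mul_div, div_le_iff₀ (by positivity)] at hWD2
      exact hWD2
    rw [← mul_div_assoc, div_le_iff₀ hVb]
    linarith
  have hexp : -(a * (σ * A)) + V * (b * (1 + 1 / m)) * (a ^ 2 / 2 * Real.exp a) ≤ -y := by
    rw [haA, ha2]
    have e1 : (1 + 1 / (m : ℝ)) * Real.exp a ≤ κ := by
      rw [← hr2]; gcongr
    calc -(σ ^ 2 * D) + V * (b * (1 + 1 / m)) * (σ ^ 2 * (D / (V * b)) / 2 * Real.exp a)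
        = -(σ ^ 2 * D) + σ ^ 2 * D / 2 * ((1 + 1 / m) * Real.exp a) := by field_simp
      _ ≤ -(σ ^ 2 * D) + σ ^ 2 * D / 2 * κ := by gcongr
      _ = -y := by rw [hκ, hy]; field_simp; ring
  let bad : ℕ → ℕ → Set Ω := fun j d => {ω | (j + d < Q ∧ d * ℓ ≤ b * (1 + 1 / m)) ∧
    ∃ n ≤ N, σ * A ≤ |countIncr (fun i => U i ω) n (j * ℓ) ((j + d : ℕ) * ℓ)|}
  have hbad : ∀ j d, P (bad j d) ≤ ENNReal.ofReal (2 * Real.exp (-y)) := by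
    intro j d
    by_cases hjd : j + d < Q ∧ d * ℓ ≤ b * (1 + 1 / m)
    · have hend : ((j + d : ℕ) : ℝ) * ℓ ≤ 1 := by
        have : ((j + d : ℕ) : ℝ) ≤ Q := by exact_mod_cast hjd.1.le
        calc ((j + d : ℕ) : ℝ) * ℓ ≤ Q * ℓ := by gcongr
          _ ≤ 1 := by rw [hQℓ]; exact hH
      have hlen : N * (((j + d : ℕ) : ℝ) * ℓ - j * ℓ) ≤ V * (b * (1 + 1 / m)) := by
        push_cast
        rw [show ((j : ℝ) + d) * ℓ - j * ℓ = d * ℓ by ring]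
        exact mul_le_mul hNV hjd.2 (by positivity) hV.le
      have hle : (j : ℝ) * ℓ ≤ ((j + d : ℕ) : ℝ) * ℓ := by gcongr; omega
      refine le_trans (measure_mono fun ω hω => hω.2)
        ((hU.measure_exists_le_abs_countIncr_le (by positivity) hle hend ha0 hlen
          (by positivity)).trans (ENNReal.ofReal_le_ofReal ?_))
      gcongr
    · have : bad j d = ∅ := by
        ext ω; simp only [Set.mem_empty_iff_false, iff_false]
        exact fun hω => hjd hω.1
      rw [this]; simp
  let osc : ℕ → Set Ω := fun j => {ω | ∃ n ≤ N, ∃ t ∈ Set.Icc (j * ℓ) (j * ℓ + ℓ),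
    100 * √(V * ℓ * y) ≤ |countIncr (fun i => U i ω) n (j * ℓ) t|}
  have hoscP : ∀ j < Q, P (osc j) ≤ ENNReal.ofReal (10 * Real.exp (-y)) := by
    intro j hj
    refine hU.measure_exists_osc_le (by positivity) hℓ0 ?_ hNV hy1 hyV
    have : (j : ℝ) + 1 ≤ Q := by exact_mod_cast hj
    calc j * ℓ + ℓ = (j + 1) * ℓ := by ring
      _ ≤ Q * ℓ := by gcongr
      _ ≤ 1 := by rw [hQℓ]; exact hH
  have hsub : {ω | ∃ n ≤ N, ∃ s t : ℝ, 0 ≤ s ∧ s ≤ t ∧ t ≤ H ∧ t - s ≤ b ∧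
        θ * A ≤ |countIncr (fun i => U i ω) n s t|} ⊆
      (⋃ j ∈ Finset.range Q, ⋃ d ∈ Finset.range (2 * m + 2), bad j d) ∪
        ⋃ j ∈ Finset.range Q, osc j := by
    rintro ω ⟨n, hn, s, t, hs, hst, htH, hts, hbig⟩
    by_contra hω
    simp only [Set.mem_union, Set.mem_iUnion, Finset.mem_range, not_or, not_exists] at hω
    obtain ⟨hω1, hω2⟩ := hω
    set u : ℕ → ℝ := fun i => U i ω with hu
    rcases hst.eq_or_lt with rfl | hst
    · have : countIncr u n s s = 0 := by simp [countIncr]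
      rw [this, abs_zero] at hbig
      have : 0 < θ * A := by positivity
      linarith
    obtain ⟨j, hj, hj1, hj2⟩ := exists_grid_cell hQpos hℓ0 hs (by rw [hQℓ]; linarith)
    obtain ⟨j', hj', hj1', hj2'⟩ := exists_grid_cell hQpos hℓ0 (hs.trans hst.le) (by rwa [hQℓ])
    have hjj : j ≤ j' := by
      have : (j : ℝ) * ℓ < (j' + 1) * ℓ := by linarith
      have := lt_of_mul_lt_mul_right this hℓ0.le
      exact Nat.lt_succ_iff.1 (by exact_mod_cast this)
    obtain ⟨d, rfl⟩ := Nat.exists_eq_add_of_le hjj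
    push_cast at hj1' hj2'
    -- Rounding both endpoints down to the grid lengthens the interval by at most one cell.
    have hdℓ : d * ℓ ≤ b + ℓ := by linarith
    have hdb : d * ℓ ≤ b * (1 + 1 / m) := by
      have : b * (1 + 1 / m) = b + b / m := by ring
      linarith
    have hd : d < 2 * m + 2 := by
      have h1 : b ≤ 2 * m * ℓ := by rwa [div_le_iff₀' (by positivity)] at hℓ2
      have h2 : (d : ℝ) * ℓ ≤ (2 * m + 1) * ℓ := by linarith
      have h3 : (d : ℝ) ≤ 2 * m + 1 := le_of_mul_le_mul_right h2 hℓ0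
      have : d ≤ 2 * m + 1 := by exact_mod_cast h3
      omega
    have b1 : |countIncr u n (j * ℓ) ((j + d : ℕ) * ℓ)| < σ * A := by
      by_contra hc
      exact hω1 j hj d hd ⟨⟨hj', hdb⟩, n, hn, not_lt.1 hc⟩
    have b2 : |countIncr u n (j * ℓ) s| < 100 * √(V * ℓ * y) := by
      by_contra hc
      exact hω2 j hj ⟨n, hn, s, ⟨hj1, hj2⟩, not_lt.1 hc⟩
    have b3 : |countIncr u n ((j + d : ℕ) * ℓ) t| < 100 * √(V * ℓ * y) := by
      by_contra hc
      exact hω2 (j + d) hj' ⟨n, hn, t, ⟨by push_cast; linarith, by push_cast; linarith⟩,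
        not_lt.1 hc⟩
    have hlt : |countIncr u n s t| < θ * A := by
      rw [abs_lt] at b1 b2 b3 ⊢
      unfold countIncr at b1 b2 b3 ⊢
      constructor <;> linarith [b1.1, b1.2, b2.1, b2.2, b3.1, b3.2]
    linarith
  calc P _ ≤ _ := measure_mono hsub
    _ ≤ (∑ j ∈ Finset.range Q, ∑ d ∈ Finset.range (2 * m + 2), P (bad j d)) +
          ∑ j ∈ Finset.range Q, P (osc j) :=
        (measure_union_le _ _).trans (add_le_add ((measure_biUnion_finset_le _ _).trans
          (Finset.sum_le_sum fun l _ => measure_biUnion_finset_le _ _))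
            (measure_biUnion_finset_le _ _))
    _ ≤ (∑ j ∈ Finset.range Q, ∑ d ∈ Finset.range (2 * m + 2),
            ENNReal.ofReal (2 * Real.exp (-y))) +
          ∑ j ∈ Finset.range Q, ENNReal.ofReal (10 * Real.exp (-y)) :=
        add_le_add (Finset.sum_le_sum fun j _ => Finset.sum_le_sum fun d _ => hbad j d)
          (Finset.sum_le_sum fun j hj => hoscP j (Finset.mem_range.1 hj))
    _ = ENNReal.ofReal (Q * (4 * m + 14) * Real.exp (-y)) := by
        rw [ENNReal.sum_range_const_ofReal (by positivity),
          ENNReal.sum_range_const_ofReal (by positivity),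
          ENNReal.sum_range_const_ofReal (by positivity),
          ← ENNReal.ofReal_add (by positivity) (by positivity)]
        congr 1
        push_cast
        ring
    _ ≤ _ := by
        apply ENNReal.ofReal_le_ofReal
        calc Q * (4 * m + 14) * Real.exp (-y)
            ≤ 2 * (H * m / b) * (4 * m + 14) * Real.exp (-y) := by gcongr
          _ = _ := by ring

end Sample

/-! ### Geometric blocks, scales and Borel-Cantelli -/

theorem log_le_four_mul_sqrt_sqrt {x : ℝ} (hx : 0 < x) : Real.log x ≤ 4 * √(√x) := by
  have h1 : Real.log x = 4 * Real.log √(√x) := by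
    rw [Real.log_sqrt (Real.sqrt_nonneg _), Real.log_sqrt hx.le]; ring
  rw [h1]
  have := Real.log_le_sub_one_of_pos (Real.sqrt_pos.2 (Real.sqrt_pos.2 hx))
  linarith

/-- The half-width of the windows in which the empirical quantiles are located. -/
noncomputable def window (θ : ℝ) (k i : ℕ) : ℝ := 2 * θ ^ 2 * √(θ ^ i * Real.log k) / θ ^ k

theorem one_le_log_nat {k : ℕ} (hk : 3 ≤ k) : 1 ≤ Real.log k := by
  have hk' : (3 : ℝ) ≤ k := by exact_mod_cast hk
  rw [Real.le_log_iff_exp_le (by linarith)]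
  linarith [Real.exp_one_lt_d9]

section Sample

variable {Ω : Type*} [MeasurableSpace Ω] {P : Measure Ω} {U : ℕ → Ω → ℝ}
  [IsProbabilityMeasure P]

/-- `C k^{-2σ}` bound for the tail of the empirical process near zero, over one block. -/
theorem IsUniformSample.exists_measure_block_sup_le (hU : IsUniformSample P U) {θ : ℝ}
    (hθ : 1 < θ) :
    ∃ C W : ℝ, 0 < C ∧ 0 < W ∧ ∀ k i : ℕ, 3 ≤ k → i ≤ k → W * Real.log k ≤ θ ^ i →
      P {ω | ∃ n : ℕ, (n : ℝ) ≤ θ ^ k ∧ ∃ t : ℝ, 0 ≤ t ∧ t ≤ θ ^ i / θ ^ k ∧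
        2 * θ * √(θ ^ i * Real.log k) ≤ |countIncr (fun i => U i ω) n 0 t|} ≤
      ENNReal.ofReal (C * Real.exp (-((1 + θ) * Real.log k))) := by
  obtain ⟨C, W, hC, hW, h⟩ := hU.exists_measure_modulus_le hθ
  refine ⟨C, 4 * W, hC, by positivity, fun k i hk hik hWk => ?_⟩
  have hL := one_le_log_nat hk
  have hθ0 : 0 < θ := by linarith
  have hH : θ ^ k * (θ ^ i / θ ^ k) = θ ^ i := by field_simp
  have hH0 : 0 < θ ^ i / θ ^ k := by positivity
  have hH1 : θ ^ i / θ ^ k ≤ 1 := by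
    rw [div_le_one (by positivity)]; exact pow_le_pow_right₀ hθ.le hik
  -- Here the window is the whole interval. The choice `D = 4 log k` gives probability `k^{-(1+θ)}`,
  -- which stays summable after a union over `k + 1` scales; it is the source of the 2 in `window`.
  have := h ⌊θ ^ k⌋₊ (θ ^ k) (θ ^ i / θ ^ k) (θ ^ i / θ ^ k) (4 * Real.log k)
    (Nat.floor_le (by positivity)) hH0 le_rfl hH1 (by linarith) (by rw [hH]; linarith)
  refine (measure_mono ?_).trans (this.trans (ENNReal.ofReal_le_ofReal (le_of_eq ?_)))
  · rintro ω ⟨n, hn, t, ht0, ht1, hbig⟩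
    refine ⟨n, Nat.le_floor hn, 0, t, le_rfl, ht0, ht1, by linarith, le_trans (le_of_eq ?_) hbig⟩
    rw [hH, show θ ^ i * (4 * Real.log k) = 2 ^ 2 * (θ ^ i * Real.log k) by ring,
      Real.sqrt_mul (by positivity), Real.sqrt_sq (by norm_num)]
    ring
  · rw [div_self hH0.ne', mul_one]
    congr 2
    ring

/-- With `M = θ^i`, the ratio of interval to window is at most `√M`. The summand `log M` in `D`
contributes `M^{-(1+θ)/4}`, leaving `M^{-(θ-1)/4}`, geometric in `i`: the union over scales costs
only a constant, and `2 log k` still yields `k^{-(1+θ)/2}`. -/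
theorem IsUniformSample.exists_measure_block_modulus_le (hU : IsUniformSample P U) {θ : ℝ}
    (hθ : 1 < θ) :
    ∃ C W : ℝ, 0 < C ∧ 0 < W ∧ ∀ k i : ℕ, 3 ≤ k → i ≤ k → W * Real.log k ≤ θ ^ i →
      P {ω | ∃ n : ℕ, (n : ℝ) ≤ θ ^ k ∧ ∃ s t : ℝ, 0 ≤ s ∧ s ≤ t ∧ t ≤ θ ^ i / θ ^ k ∧
        t - s ≤ window θ k i ∧
        θ * √(θ ^ k * window θ k i * (2 * Real.log k + Real.log (θ ^ i))) ≤
          |countIncr (fun i => U i ω) n s t|} ≤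
      ENNReal.ofReal (C * Real.exp (-((1 + θ) / 2 * Real.log k)) *
        Real.exp (-((θ - 1) / 4 * Real.log θ)) ^ i) := by
  obtain ⟨C, W, hC, hW, h⟩ := hU.exists_measure_modulus_le hθ
  have hθ0 : 0 < θ := by linarith
  -- The first two entries give `2WL ≤ √(ML)` and `W log M ≤ √M`, together the lower bound on `V b`;
  -- the third makes the window no longer than the interval.
  refine ⟨C, max (4 * W ^ 2) (max ((4 * W) ^ 4) (4 * θ ^ 4)), hC, by positivity,
    fun k i hk hik hWk => ?_⟩
  have hL := one_le_log_nat hk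
  set L := Real.log k with hLdef
  have hW1 : 4 * W ^ 2 * L ≤ θ ^ i := le_trans (by gcongr; exact le_max_left _ _) hWk
  have hW2 : (4 * W) ^ 4 * L ≤ θ ^ i :=
    le_trans (by gcongr; exact (le_max_left _ _).trans (le_max_right _ _)) hWk
  have hW3 : 4 * θ ^ 4 * L ≤ θ ^ i :=
    le_trans (by gcongr; exact (le_max_right _ _).trans (le_max_right _ _)) hWk
  have hM : (1 : ℝ) ≤ θ ^ i := one_le_pow₀ hθ.le
  set M := θ ^ i with hMdef
  have hM0 : 0 < M := by linarith
  have hH1 : M / θ ^ k ≤ 1 := by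
    rw [div_le_one (by positivity)]; exact pow_le_pow_right₀ hθ.le hik
  have hlogM : 0 ≤ Real.log M := Real.log_nonneg hM
  have hVb : θ ^ k * window θ k i = 2 * θ ^ 2 * √(M * L) := by
    rw [window, mul_div_cancel₀ _ (by positivity)]
  have hs0 : 0 < √(M * L) := Real.sqrt_pos.2 (by positivity)
  have hb0 : 0 < window θ k i := by unfold window; positivity
  have hθ2 : 1 ≤ θ ^ 2 := one_le_pow₀ hθ.le
  have hbH : window θ k i ≤ M / θ ^ k := by
    rw [window]
    gcongr
    apply (pow_le_pow_iff_left₀ (by positivity) (by positivity) two_ne_zero).1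
    rw [mul_pow, Real.sq_sqrt (by positivity)]
    nlinarith
  have hsM : √M ≤ √(M * L) := Real.sqrt_le_sqrt (by nlinarith)
  have hWD : W * (2 * L + Real.log M) ≤ θ ^ k * window θ k i := by
    rw [hVb]
    have e1 : 2 * W * L ≤ √(M * L) := by
      apply Real.le_sqrt_of_sq_le
      nlinarith
    have e2 : W * Real.log M ≤ √M := by
      have e3 : 4 * W ≤ √(√M) := by
        apply Real.le_sqrt_of_sq_le
        apply Real.le_sqrt_of_sq_le
        calc ((4 * W) ^ 2) ^ 2 = (4 * W) ^ 4 * 1 := by ring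
          _ ≤ (4 * W) ^ 4 * L := by gcongr
          _ ≤ M := hW2
      calc W * Real.log M ≤ W * (4 * √(√M)) := by gcongr; exact log_le_four_mul_sqrt_sqrt hM0
        _ = 4 * W * √(√M) := by ring
        _ ≤ √(√M) * √(√M) := by gcongr
        _ = √M := Real.mul_self_sqrt (Real.sqrt_nonneg _)
    nlinarith
  have := h ⌊θ ^ k⌋₊ (θ ^ k) (window θ k i) (M / θ ^ k) (2 * L + Real.log M)
    (Nat.floor_le (by positivity)) hb0 hbH hH1 (by linarith) hWD
  refine (measure_mono ?_).trans (this.trans (ENNReal.ofReal_le_ofReal ?_))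
  · rintro ω ⟨n, hn, s, t, h1, h2, h3, h4, hbig⟩
    exact ⟨n, Nat.le_floor hn, s, t, h1, h2, h3, h4, hbig⟩
  · have hHb : M / θ ^ k / window θ k i ≤ √M := by
      rw [div_div, hVb, div_le_iff₀ (by positivity)]
      calc M = √M * √M := (Real.mul_self_sqrt hM0.le).symm
        _ ≤ √M * √(M * L) := by gcongr
        _ ≤ √M * (2 * θ ^ 2 * √(M * L)) := by gcongr; nlinarith
    have hsq : √M = Real.exp (Real.log M / 2) := by
      rw [← Real.log_sqrt hM0.le, Real.exp_log (Real.sqrt_pos.2 hM0)]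
    calc C * (M / θ ^ k / window θ k i) * Real.exp (-((1 + θ) / 2 * (2 * L + Real.log M) / 2))
        ≤ C * √M * Real.exp (-((1 + θ) / 2 * (2 * L + Real.log M) / 2)) := by gcongr
      _ = _ := by
        rw [hsq, ← Real.exp_nat_mul, mul_assoc, mul_assoc, ← Real.exp_add, ← Real.exp_add]
        have : Real.log M = i * Real.log θ := by rw [hMdef, Real.log_pow]
        rw [this]
        congr 2
        ring

/-- Almost surely, in all but finitely many blocks the empirical process obeys the bounds of the
law of the iterated logarithm near zero and of its modulus of continuity, at all scales. -/
theorem IsUniformSample.ae_eventually_block (hU : IsUniformSample P U) {θ : ℝ} (hθ : 1 < θ) :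
    ∃ W : ℝ, 0 < W ∧ ∀ᵐ ω ∂P, ∀ᶠ k : ℕ in atTop, ∀ i ≤ k, W * Real.log k ≤ θ ^ i →
      ∀ n : ℕ, (n : ℝ) ≤ θ ^ k →
      (∀ t : ℝ, 0 ≤ t → t ≤ θ ^ i / θ ^ k →
        |countIncr (fun i => U i ω) n 0 t| < 2 * θ * √(θ ^ i * Real.log k)) ∧
      ∀ s t : ℝ, 0 ≤ s → s ≤ t → t ≤ θ ^ i / θ ^ k → t - s ≤ window θ k i →
        |countIncr (fun i => U i ω) n s t| <
          θ * √(θ ^ k * window θ k i * (2 * Real.log k + Real.log (θ ^ i))) := by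
  obtain ⟨C₁, W₁, hC₁, hW₁, h₁⟩ := hU.exists_measure_block_sup_le hθ
  obtain ⟨C₂, W₂, hC₂, hW₂, h₂⟩ := hU.exists_measure_block_modulus_le hθ
  refine ⟨max W₁ W₂, lt_max_of_lt_left hW₁, ?_⟩
  set g := Real.exp (-((θ - 1) / 4 * Real.log θ)) with hg
  have hg0 : 0 < g := Real.exp_pos _
  have hg1 : g < 1 := by
    rw [hg, Real.exp_lt_one_iff]
    have := Real.log_pos hθ
    have : 0 < (θ - 1) / 4 * Real.log θ := mul_pos (by linarith) this
    linarith
  -- The admissibility condition is part of the event, so inadmissible pairs give the empty set and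
  -- the probability bounds hold for all `i ≤ k`.
  let A : ℕ → ℕ → Set Ω := fun k i => {ω | (3 ≤ k ∧ max W₁ W₂ * Real.log k ≤ θ ^ i) ∧
    ∃ n : ℕ, (n : ℝ) ≤ θ ^ k ∧ ∃ t : ℝ, 0 ≤ t ∧ t ≤ θ ^ i / θ ^ k ∧
        2 * θ * √(θ ^ i * Real.log k) ≤ |countIncr (fun i => U i ω) n 0 t|}
  let B : ℕ → ℕ → Set Ω := fun k i => {ω | (3 ≤ k ∧ max W₁ W₂ * Real.log k ≤ θ ^ i) ∧
    ∃ n : ℕ, (n : ℝ) ≤ θ ^ k ∧ ∃ s t : ℝ, 0 ≤ s ∧ s ≤ t ∧ t ≤ θ ^ i / θ ^ k ∧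
        t - s ≤ window θ k i ∧
        θ * √(θ ^ k * window θ k i * (2 * Real.log k + Real.log (θ ^ i))) ≤
          |countIncr (fun i => U i ω) n s t|}
  let bad : ℕ → Set Ω := fun k => ⋃ i ∈ Finset.range (k + 1), (A k i ∪ B k i)
  have hA : ∀ k i, i ≤ k → 3 ≤ k →
      P (A k i) ≤ ENNReal.ofReal (C₁ * Real.exp (-((1 + θ) * Real.log k))) := by
    intro k i hik hk
    by_cases hc : 3 ≤ k ∧ max W₁ W₂ * Real.log k ≤ θ ^ i
    · refine (measure_mono fun ω hω => hω.2).trans (h₁ k i hk hik (le_trans ?_ hc.2))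
      have := one_le_log_nat hk
      gcongr
      exact le_max_left _ _
    · have : A k i = ∅ := Set.eq_empty_of_forall_notMem fun ω hω => hc hω.1
      rw [this]; simp
  have hB : ∀ k i, i ≤ k → 3 ≤ k →
      P (B k i) ≤ ENNReal.ofReal (C₂ * Real.exp (-((1 + θ) / 2 * Real.log k)) * g ^ i) := by
    intro k i hik hk
    by_cases hc : 3 ≤ k ∧ max W₁ W₂ * Real.log k ≤ θ ^ i
    · refine (measure_mono fun ω hω => hω.2).trans (h₂ k i hk hik (le_trans ?_ hc.2))
      have := one_le_log_nat hk
      gcongr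
      exact le_max_right _ _
    · have : B k i = ∅ := Set.eq_empty_of_forall_notMem fun ω hω => hc hω.1
      rw [this]; simp
  set C := 2 * C₁ + C₂ / (1 - g) with hC
  have hC0 : 0 ≤ C := by
    have : 0 < 1 - g := by linarith
    positivity
  have hbad : ∀ k, P (bad k) ≤ ENNReal.ofReal (C * (k : ℝ) ^ (-((1 + θ) / 2))) := by
    intro k
    by_cases hk : 3 ≤ k
    · have hL := one_le_log_nat hk
      have hk0 : (0 : ℝ) < k := by exact_mod_cast (show 0 < k by omega)
      calc P (bad k) ≤ ∑ i ∈ Finset.range (k + 1), P (A k i ∪ B k i) :=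
            measure_biUnion_finset_le _ _
        _ ≤ ∑ i ∈ Finset.range (k + 1),
            ENNReal.ofReal (C₁ * Real.exp (-((1 + θ) * Real.log k)) +
              C₂ * Real.exp (-((1 + θ) / 2 * Real.log k)) * g ^ i) := by
            refine Finset.sum_le_sum fun i hi => ?_
            have hik : i ≤ k := Nat.lt_succ_iff.1 (Finset.mem_range.1 hi)
            rw [ENNReal.ofReal_add (by positivity) (by positivity)]
            exact (measure_union_le _ _).trans (add_le_add (hA k i hik hk) (hB k i hik hk))
        _ = ENNReal.ofReal (∑ i ∈ Finset.range (k + 1),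
            (C₁ * Real.exp (-((1 + θ) * Real.log k)) +
              C₂ * Real.exp (-((1 + θ) / 2 * Real.log k)) * g ^ i)) :=
            (ENNReal.ofReal_sum_of_nonneg fun _ _ => by positivity).symm
        _ ≤ _ := by
            apply ENNReal.ofReal_le_ofReal
            have e0 : (k : ℝ) ^ (-((1 + θ) / 2)) = Real.exp (-((1 + θ) / 2 * Real.log k)) := by
              rw [Real.rpow_def_of_pos hk0]; ring_nf
            rw [e0, Finset.sum_add_distrib, Finset.sum_const, Finset.card_range,
              nsmul_eq_mul, ← Finset.mul_sum]
            have e1 : ∑ i ∈ Finset.range (k + 1), g ^ i ≤ 1 / (1 - g) := by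
              have := geom_sum_Ico_le_of_lt_one (m := 0) (n := k + 1) hg0.le hg1
              simpa using this
            -- The first family has no decay in `i`; its `k + 1` scales reduce `k^{-(1+θ)}` to `2
            -- k^{-θ}`, still below the bound of the second family.
            have e2 : ((k + 1 : ℕ) : ℝ) * Real.exp (-((1 + θ) * Real.log k)) ≤
                2 * Real.exp (-((1 + θ) / 2 * Real.log k)) := by
              have e3 : ((k + 1 : ℕ) : ℝ) ≤ 2 * Real.exp (Real.log k) := by
                rw [Real.exp_log hk0]; push_cast
                have : (1 : ℝ) ≤ k := by exact_mod_cast (show 1 ≤ k by omega)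
                linarith
              calc _ ≤ 2 * Real.exp (Real.log k) * Real.exp (-((1 + θ) * Real.log k)) := by gcongr
                _ = 2 * Real.exp (Real.log k - (1 + θ) * Real.log k) := by
                    rw [mul_assoc, ← Real.exp_add]; ring_nf
                _ ≤ _ := by
                    gcongr
                    nlinarith
            calc _ = C₁ * (((k + 1 : ℕ) : ℝ) * Real.exp (-((1 + θ) * Real.log k))) +
                  C₂ * Real.exp (-((1 + θ) / 2 * Real.log k)) *
                    ∑ i ∈ Finset.range (k + 1), g ^ i := by ring
              _ ≤ C₁ * (2 * Real.exp (-((1 + θ) / 2 * Real.log k))) +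
                  C₂ * Real.exp (-((1 + θ) / 2 * Real.log k)) * (1 / (1 - g)) := by gcongr
              _ = _ := by rw [hC]; ring
    · have : bad k = ∅ := by
        apply Set.eq_empty_of_forall_notMem
        intro ω hω
        simp only [bad, Set.mem_iUnion] at hω
        obtain ⟨i, -, h | h⟩ := hω
        · exact hk h.1.1
        · exact hk h.1.1
      rw [this]; simp
  have hsum : ∑' k, P (bad k) ≠ ∞ := by
    have hs : Summable fun k : ℕ => C * (k : ℝ) ^ (-((1 + θ) / 2)) :=
      (Real.summable_nat_rpow.2 (by linarith)).mul_left C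
    exact ne_top_of_le_ne_top hs.tsum_ofReal_ne_top (ENNReal.tsum_le_tsum hbad)
  filter_upwards [ae_eventually_notMem hsum] with ω hω
  filter_upwards [hω, eventually_ge_atTop 3] with k hk hk3 i hik hWk n hn
  simp only [bad, Set.mem_iUnion, Finset.mem_range, not_exists, Nat.lt_succ_iff, Set.mem_union,
    not_or] at hk
  obtain ⟨hkA, hkB⟩ := hk i hik
  refine ⟨fun t ht0 ht1 => ?_, fun s t hs hst ht hts => ?_⟩
  · by_contra hc
    exact hkA ⟨⟨hk3, hWk⟩, n, hn, t, ht0, ht1, not_lt.1 hc⟩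
  · by_contra hc
    exact hkB ⟨⟨hk3, hWk⟩, n, hn, s, t, hs, hst, ht, hts, not_lt.1 hc⟩

end Sample

/-! ### From the modulus of continuity to the quantiles -/

theorem le_empCdf_iff {u : ℕ → ℝ} {n : ℕ} (hn : 0 < n) {s t : ℝ} :
    t ≤ empCdf u n s ↔ n * (t - s) ≤ centeredCount u n s := by
  have hn' : (0 : ℝ) < n := by exact_mod_cast hn
  rw [empCdf, centeredCount, inv_mul_eq_div, le_div_iff₀ hn']
  constructor <;> intro h <;> linarith

theorem centeredCount_zero {u : ℕ → ℝ} (hu : ∀ i, 0 < u i) (n : ℕ) : centeredCount u n 0 = 0 := by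
  have : (Finset.range n).filter (fun i => u i ≤ 0) = ∅ :=
    Finset.filter_eq_empty_iff.2 fun i _ => not_le.2 (hu i)
  simp [centeredCount, this]

theorem empQuantile_zero (u : ℕ → ℝ) (n : ℕ) : empQuantile u n 0 = 0 := by
  have : {s : ℝ | 0 ≤ s ∧ 0 ≤ empCdf u n s} = Set.Ici 0 := by
    ext s
    simp only [Set.mem_ofPred_eq, Set.mem_Ici, and_iff_left_iff_imp]
    intro _
    unfold empCdf
    positivity
  rw [empQuantile, this, csInf_Ici]

/-- The sum of the empirical and the quantile process is controlled by the modulus of continuity of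
the empirical process over windows that are wide enough to contain the quantiles. -/
theorem abs_centeredCount_add_quantile_le {u : ℕ → ℝ} {n : ℕ} {t b H X : ℝ} (hu : ∀ i, 0 < u i)
    (hn : 0 < n) (ht : 0 < t) (hb : 0 < b) (htH : t + b ≤ H)
    (hA : ∀ x, 0 ≤ x → x ≤ H → |countIncr u n 0 x| < n * b)
    (hB : ∀ s x, 0 ≤ s → s ≤ x → x ≤ H → x - s ≤ b → |countIncr u n s x| ≤ X) :
    |centeredCount u n t + n * (empQuantile u n t - t)| ≤ X := by
  have hn' : (0 : ℝ) < n := by exact_mod_cast hn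
  have hA' : ∀ x, 0 ≤ x → x ≤ H → |centeredCount u n x| < n * b := by
    intro x h1 h2
    simpa [countIncr, centeredCount_zero hu] using hA x h1 h2
  have hB' : ∀ x, 0 ≤ x → x ≤ H → t - b ≤ x → x ≤ t + b →
      |centeredCount u n t - centeredCount u n x| ≤ X := by
    intro x h1 h2 h3 h4
    rcases le_total x t with h | h
    · exact hB x t h1 h (by linarith) (by linarith)
    · rw [abs_sub_comm]
      exact hB t x ht.le h h2 (by linarith)
  set S := {s : ℝ | 0 ≤ s ∧ t ≤ empCdf u n s} with hS
  set q := empQuantile u n t with hq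
  have hqS : q = sInf S := rfl
  have hbdd : BddBelow S := ⟨0, fun s hs => hs.1⟩
  have htop : t + b ∈ S := by
    refine ⟨by linarith, (le_empCdf_iff hn).2 ?_⟩
    have := (abs_lt.1 (hA' (t + b) (by linarith) htH)).1
    linarith
  have hqtop : q ≤ t + b := csInf_le hbdd htop
  have hlow : ∀ s, 0 ≤ s → s ≤ t - b → s ∉ S := by
    intro s hs0 hs hsS
    have h1 := (le_empCdf_iff hn).1 hsS.2
    have h2 := (abs_lt.1 (hA' s hs0 (by linarith))).2
    have h3 : (n : ℝ) * b ≤ n * (t - s) := by gcongr; linarith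
    linarith
  have hq0 : 0 ≤ q := le_csInf ⟨_, htop⟩ fun s hs => hs.1
  -- The identity `c(q) = n(t - q)` can fail at a jump, so `q` is approached within `ε / n` from
  -- each side: points of `S` give the lower bound, points outside `S` the upper one.
  refine le_of_forall_pos_le_add fun ε hε => ?_
  set η := ε / n with hη
  have hη0 : 0 < η := by positivity
  have hnη : n * η = ε := by rw [hη]; field_simp
  rw [abs_le]
  constructor
  · obtain ⟨s, hs, hsq⟩ : ∃ s ∈ S, s < q + η :=
      exists_lt_of_csInf_lt ⟨_, htop⟩ (by linarith)
    obtain ⟨x, hx, hxq, hxt⟩ : ∃ x ∈ S, x < q + η ∧ x ≤ t + b := by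
      rcases le_total s (t + b) with h | h
      · exact ⟨s, hs, hsq, h⟩
      · exact ⟨t + b, htop, by linarith, le_rfl⟩
    have hxlow : t - b ≤ x := by
      by_contra hc
      exact hlow x hx.1 (by linarith) hx
    have h1 := (le_empCdf_iff hn).1 hx.2
    have h2 := (abs_le.1 (hB' x hx.1 (by linarith) hxlow hxt)).1
    have h3 : (n : ℝ) * (x - q) ≤ n * η := by gcongr; linarith
    linarith
  -- The maximum keeps `x` nonnegative and inside the window. Each of its three values lies outside
  -- `S`: below the infimum, at most `t - b`, or at 0, where the count vanishes while `t > 0`.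
  · set x := max (q - η) (max (t - b) 0) with hx
    have hx0 : 0 ≤ x := (le_max_right _ _).trans (le_max_right _ _)
    have hxlow : t - b ≤ x := (le_max_left _ _).trans (le_max_right _ _)
    have hxt : x ≤ t + b := by
      apply max_le (by linarith) (max_le (by linarith) (by linarith))
    have hxS : x ∉ S := by
      rcases max_choice (q - η) (max (t - b) 0) with h | h
      · intro hc
        have := csInf_le hbdd hc
        rw [← hqS, hx, h] at this
        linarith
      · rcases max_choice (t - b) 0 with h' | h'
        · have h : x = t - b := by rw [hx, h, h']
          exact hlow x hx0 h.le
        · have h : x = 0 := by rw [hx, h, h']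
          intro hc
          have h1 := (le_empCdf_iff hn).1 hc.2
          rw [h, centeredCount_zero hu] at h1
          have : 0 < n * (t - 0) := by rw [sub_zero]; positivity
          linarith
    have h1 : centeredCount u n x < n * (t - x) := by
      by_contra hc
      exact hxS ⟨hx0, (le_empCdf_iff hn).2 (not_lt.1 hc)⟩
    have h2 := (abs_le.1 (hB' x hx0 (by linarith) hxlow hxt)).2
    have h3 : (n : ℝ) * (q - x) ≤ n * η := by
      gcongr
      linarith [le_max_left (q - η) (max (t - b) 0)]
    linarith

/-- Both processes vanish at 0, so the local processes are the global ones at `h s`, and one `X`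
serves every `s` because all windows stay in `[0, H]`. -/
theorem bkRemainder_le {u : ℕ → ℝ} {n : ℕ} {h b H X : ℝ} (hu : ∀ i, 0 < u i)
    (hn : 0 < n) (hh : 0 < h) (hb : 0 < b) (hhH : h + b ≤ H)
    (hA : ∀ x, 0 ≤ x → x ≤ H → |countIncr u n 0 x| < n * b)
    (hB : ∀ s x, 0 ≤ s → s ≤ x → x ≤ H → x - s ≤ b → |countIncr u n s x| ≤ X) :
    bkRemainder u n h ≤ ENNReal.ofReal (X / √n) := by
  have hn' : (0 : ℝ) < n := by exact_mod_cast hn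
  have hX : 0 ≤ X := (abs_nonneg _).trans (hB 0 0 le_rfl le_rfl (by linarith) (by linarith))
  have hproc : ∀ t, empProcess u n t + quantileProcess u n t =
      (centeredCount u n t + n * (empQuantile u n t - t)) / √n := by
    intro t
    have hs : √(n : ℝ) ≠ 0 := (Real.sqrt_pos.2 hn').ne'
    have hss : √(n : ℝ) ^ 2 = n := Real.sq_sqrt hn'.le
    rw [empProcess, quantileProcess, empCdf, centeredCount, eq_div_iff hs]
    set c := (((Finset.range n).filter (fun i => u i ≤ t)).card : ℝ)
    calc _ = √(n : ℝ) ^ 2 * ((n : ℝ)⁻¹ * c - t) + √(n : ℝ) ^ 2 * (empQuantile u n t - t) := by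
          ring
      _ = _ := by rw [hss]; field_simp
  refine iSup₂_le fun s hs => ENNReal.ofReal_le_ofReal ?_
  have h0 : empProcess u n 0 + quantileProcess u n 0 = 0 := by
    rw [hproc, centeredCount_zero hu, empQuantile_zero]; simp
  have he : localEmp u n h 0 s + localQuantile u n h 0 s =
      (centeredCount u n (h * s) + n * (empQuantile u n (h * s) - h * s)) / √n := by
    rw [← hproc, localEmp, localQuantile, zero_add]
    linarith
  simp only [he]
  rw [abs_div, abs_of_nonneg (Real.sqrt_nonneg _)]
  gcongr
  rcases hs.1.eq_or_lt with h1 | h1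
  · rw [← h1, mul_zero, centeredCount_zero hu, empQuantile_zero]
    simpa using hX
  · refine abs_centeredCount_add_quantile_le hu hn (by positivity) hb ?_ hA hB
    have : h * s ≤ h * 1 := by gcongr; exact hs.2
    linarith

/-! ### Comparison with the rate, uniformly in `h` -/

/-- Comparison of the bound obtained on a block with the normalising rate. -/
theorem block_bound_le_rate {θ h N M L lam X n : ℝ} (hθ : 1 < θ) (hn : 0 < n) (hh : 0 < h)
    (hL : 0 ≤ L) (hM1 : 1 ≤ M) (hnh : 1 ≤ n * h) (hlam : 0 < lam) (hNn : N ≤ θ * n)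
    (hM : M ≤ θ ^ 2 * (N * h))
    (hLlam : L ≤ (1 + θ) / 2 * lam) (hlog : 3 * Real.log θ ≤ (θ - 1) * lam)
    (hX : X = θ * √(2 * θ ^ 2 * √(M * L) * (2 * L + Real.log M))) :
    X / √n ≤ √2 * θ ^ 4 * √(√(h * lam / n) * (2 * lam + Real.log (n * h))) := by
  have hθ0 : 0 < θ := by linarith
  have hlognh : 0 ≤ Real.log (n * h) := Real.log_nonneg hnh
  have hlogM : 0 ≤ Real.log M := Real.log_nonneg hM1
  have hM3 : M ≤ θ ^ 3 * (n * h) := by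
    calc M ≤ θ ^ 2 * (N * h) := hM
      _ ≤ θ ^ 2 * (θ * n * h) := by gcongr
      _ = _ := by ring
  have hD : 2 * L + Real.log M ≤ θ * (2 * lam + Real.log (n * h)) := by
    have h1 : Real.log M ≤ 3 * Real.log θ + Real.log (n * h) := by
      calc Real.log M ≤ Real.log (θ ^ 3 * (n * h)) := Real.log_le_log (by linarith) hM3
        _ = _ := by rw [Real.log_mul (by positivity) (by positivity), Real.log_pow]; norm_num
    have h2 : Real.log (n * h) ≤ θ * Real.log (n * h) := le_mul_of_one_le_left hlognh hθ.le
    linarith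
  have ha : √(M * L) ≤ θ ^ 2 * (n * √(h * lam / n)) := by
    apply Real.sqrt_le_iff.2 ⟨by positivity, ?_⟩
    rw [mul_pow, mul_pow, Real.sq_sqrt (by positivity)]
    calc M * L ≤ θ ^ 3 * (n * h) * (θ * lam) := by
          gcongr
          exact hLlam.trans (by gcongr; linarith)
      _ = _ := by field_simp
  rw [hX, div_le_iff₀ (Real.sqrt_pos.2 hn)]
  apply (pow_le_pow_iff_left₀ (by positivity) (by positivity) two_ne_zero).1
  have hd : 0 ≤ 2 * lam + Real.log (n * h) := by positivity
  rw [mul_pow, mul_pow, mul_pow, mul_pow, Real.sq_sqrt (by positivity),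
    Real.sq_sqrt (by positivity), Real.sq_sqrt (by positivity), Real.sq_sqrt hn.le]
  -- In the squared bound, `θ²` comes from the modulus, `θ²` from the window, `θ²` from `√(ML)` and
  -- `θ` from the logarithmic factor.
  have h1 : θ ^ 7 ≤ (θ ^ 4) ^ 2 := by
    rw [← pow_mul]; exact pow_le_pow_right₀ hθ.le (by norm_num)
  calc θ ^ 2 * (2 * θ ^ 2 * √(M * L) * (2 * L + Real.log M))
      ≤ θ ^ 2 * (2 * θ ^ 2 * (θ ^ 2 * (n * √(h * lam / n))) *
          (θ * (2 * lam + Real.log (n * h)))) := by gcongr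
    _ = 2 * θ ^ 7 * (√(h * lam / n) * (2 * lam + Real.log (n * h))) * n := by ring
    _ ≤ _ := by gcongr

theorem log₂_eq {n : ℕ} (hn : 3 ≤ n) : log₂ n = Real.log (Real.log n) := by
  have : (3 : ℝ) ≤ n := by exact_mod_cast hn
  rw [log₂, max_eq_left this]

theorem tendsto_log₂ : Tendsto (fun n : ℕ => log₂ n) atTop atTop := by
  have : Tendsto (fun n : ℕ => Real.log (Real.log n)) atTop atTop :=
    Real.tendsto_log_atTop.comp (Real.tendsto_log_atTop.comp tendsto_natCast_atTop_atTop)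
  refine this.congr' ?_
  filter_upwards [eventually_ge_atTop 3] with n hn
  rw [log₂_eq hn]

/-- The logarithm of the index of the geometric block containing `n` is at most a multiple, close
to one, of the iterated logarithm of `n`. -/
theorem log_block_le {θ : ℝ} (hθ : 1 < θ) {n k : ℕ} (hn : 3 ≤ n) (hk : θ ^ k ≤ n)
    (h1 : Real.log θ ≤ Real.log n)
    (h2 : Real.log (2 / Real.log θ) ≤ (θ - 1) / 2 * log₂ n) :
    Real.log (k + 1 : ℕ) ≤ (1 + θ) / 2 * log₂ n := by
  have hlθ := Real.log_pos hθ
  have hln : 0 < Real.log n := by linarith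
  have h3 : ((k + 1 : ℕ) : ℝ) ≤ 2 / Real.log θ * Real.log n := by
    rw [div_mul_eq_mul_div, le_div_iff₀ hlθ]
    have : k * Real.log θ ≤ Real.log n := by
      rw [← Real.log_pow]
      exact Real.log_le_log (by positivity) hk
    push_cast
    linarith
  calc Real.log (k + 1 : ℕ) ≤ Real.log (2 / Real.log θ * Real.log n) :=
        Real.log_le_log (by positivity) h3
    _ = Real.log (2 / Real.log θ) + log₂ n := by
        rw [Real.log_mul (by positivity) hln.ne', log₂_eq hn]
    _ ≤ _ := by linarith

section Sample

variable {Ω : Type*} [MeasurableSpace Ω] {P : Measure Ω} {U : ℕ → Ω → ℝ}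
  [IsProbabilityMeasure P]

theorem IsUniformSample.ae_eventually_bkRemainder_le (hU : IsUniformSample P U) {θ : ℝ}
    (hθ : 1 < θ) {hlow hupp : ℕ → ℝ} (hlow_cond : LocalStrongInvariance hlow)
    (hupp_cond : LocalStrongInvariance hupp) :
    ∀ᵐ ω ∂P, ∀ᶠ n : ℕ in atTop, ∀ h ∈ Set.Icc (hlow n) (hupp n),
      0 < rRate n h ∧
      bkRemainder (fun i => U i ω) n h ≤ ENNReal.ofReal (√2 * θ ^ 4 * rRate n h) := by
  obtain ⟨W, hW, hblock⟩ := hU.ae_eventually_block hθ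
  have hθ0 : 0 < θ := by linarith
  have hlθ := Real.log_pos hθ
  -- The second entry forces `b ≤ (1 - 1/θ) M / N`; together with `h ≤ M / (θ N)` this gives `h + b
  -- ≤ M / N`.
  set W' := max W (4 * θ ^ 4 / (1 - 1 / θ) ^ 2) with hW'
  have hθi : 0 < 1 - 1 / θ := by
    have : 1 / θ < 1 := (div_lt_one hθ0).2 hθ
    linarith
  have hW'0 : 0 < W' := lt_max_of_lt_left hW
  filter_upwards [hblock, hU.ae_pos] with ω hω hpos
  obtain ⟨k₀, hk₀⟩ := eventually_atTop.1 hω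
  have hlog : Tendsto (fun n : ℕ => Real.log n) atTop atTop :=
    Real.tendsto_log_atTop.comp tendsto_natCast_atTop_atTop
  filter_upwards [eventually_ge_atTop 3, tendsto_log₂.eventually_ge_atTop 1,
    tendsto_log₂.eventually_ge_atTop (Real.log (2 / Real.log θ) / ((θ - 1) / 2)),
    tendsto_log₂.eventually_ge_atTop (3 * Real.log θ / (θ - 1)),
    hlog.eventually_ge_atTop (Real.log θ),
    hlow_cond.tendsto_div.eventually_ge_atTop (W' * ((1 + θ) / 2)),
    hlow_cond.tendsto_mul.eventually_ge_atTop 1,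
    hupp_cond.tendsto_zero.eventually_le_const (show 0 < 1 / θ ^ 2 by positivity),
    tendsto_natCast_atTop_atTop.eventually_ge_atTop (θ ^ k₀)]
    with n hn3 hlam1 hlam2 hlam3 hlogn hdiv hmul hzero hnk h ⟨hh1, hh2⟩
  have hn0 : 0 < n := by omega
  have hn' : (0 : ℝ) < n := by exact_mod_cast hn0
  have hh : 0 < h := (hlow_cond.pos n (by omega)).trans_le hh1
  have hlam0 : 0 < log₂ n := by linarith
  rw [div_le_iff₀ (by linarith)] at hlam2 hlam3
  rw [le_div_iff₀ hlam0] at hdiv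
  have hnh : n * hlow n ≤ n * h := by gcongr
  have hnh1 : 1 ≤ n * h := hmul.trans hnh
  have hr : 0 < rRate n h := by
    have : 0 ≤ Real.log (n * h) := Real.log_nonneg hnh1
    rw [rRate, aRate, dRate]
    positivity
  refine ⟨hr, ?_⟩
  -- the block
  obtain ⟨k, hk1, hk2⟩ := exists_nat_pow_near (x := (n : ℝ))
    (by exact_mod_cast hn0) hθ
  have hkk₀ : k₀ ≤ k + 1 := by
    have := hnk.trans_lt hk2
    exact ((pow_lt_pow_iff_right₀ hθ).1 this).le
  have hL := log_block_le hθ hn3 hk1 hlogn (by linarith)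
  have hL0 : 0 ≤ Real.log (k + 1 : ℕ) := Real.log_natCast_nonneg _
  set L := Real.log (k + 1 : ℕ) with hLdef
  set N := θ ^ (k + 1) with hN
  have hN0 : 0 < N := by positivity
  have hNn : N ≤ θ * n := by
    rw [hN, pow_succ, mul_comm]; gcongr
  -- the scale
  have hNh : n * h ≤ N * h := by gcongr
  have hNhθ : n * h ≤ θ * (N * h) := hNh.trans (le_mul_of_one_le_left (by positivity) hθ.le)
  -- Bracketing `θ N h` instead of `N h` yields `M > θ N h`, hence room for a window to the right of
  -- `h`.
  obtain ⟨i, hi1, hi2⟩ := exists_nat_pow_near (x := θ * (N * h))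
    (hnh1.trans hNhθ) hθ
  have hM1 : (1 : ℝ) ≤ θ ^ (i + 1) := one_le_pow₀ hθ.le
  have hM2 : θ ^ (i + 1) ≤ θ ^ 2 * (N * h) := by
    calc θ ^ (i + 1) = θ ^ i * θ := pow_succ _ _
      _ ≤ θ * (N * h) * θ := by gcongr
      _ = θ ^ 2 * (N * h) := by ring
  have hik : i + 1 ≤ k + 1 := by
    refine (pow_le_pow_iff_right₀ hθ).1 (hM2.trans ?_)
    have : h ≤ 1 / θ ^ 2 := hh2.trans hzero
    rw [le_div_iff₀ (by positivity)] at this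
    calc θ ^ 2 * (N * h) = (h * θ ^ 2) * N := by ring
      _ ≤ 1 * N := by gcongr
      _ = N := one_mul _
  set M := θ ^ (i + 1) with hM
  have hM0 : 0 < M := by linarith
  have hWM : W' * L ≤ M := by
    calc W' * L ≤ W' * ((1 + θ) / 2 * log₂ n) := by gcongr
      _ = W' * ((1 + θ) / 2) * log₂ n := by ring
      _ ≤ n * h := hdiv.trans hnh
      _ ≤ M := hNhθ.trans hi2.le
  have hWM1 : W * L ≤ M := le_trans (by gcongr; exact le_max_left _ _) hWM
  have hWM2 : 4 * θ ^ 4 / (1 - 1 / θ) ^ 2 * L ≤ M :=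
    le_trans (by gcongr; exact le_max_right _ _) hWM
  obtain ⟨hA, hB⟩ := hk₀ (k + 1) hkk₀ (i + 1) hik hWM1 n hk2.le
  rw [← hM, ← hN, ← hLdef] at hA hB
  set b := window θ (k + 1) (i + 1) with hb
  have hL1 : 0 < L := Real.log_pos (by
    have : k ≠ 0 := by
      rintro rfl
      rw [hN] at hk2
      have h1 := Real.log_lt_log hn' hk2
      rw [zero_add, pow_one] at h1
      linarith
    exact_mod_cast (show 1 < k + 1 by omega))
  have hNb : N * b = 2 * θ ^ 2 * √(M * L) := by
    rw [hb, window, mul_div_cancel₀ _ hN0.ne']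
  have hsML : 0 < √(M * L) := Real.sqrt_pos.2 (by positivity)
  have hb0 : 0 < b := pos_of_mul_pos_right (by rw [hNb]; positivity) hN0.le
  have hhb : h + b ≤ M / N := by
    have e1 : N * b ≤ (1 - 1 / θ) * M := by
      rw [hNb]
      apply (pow_le_pow_iff_left₀ (by positivity) (by positivity) two_ne_zero).1
      rw [div_mul_eq_mul_div, div_le_iff₀ (by positivity)] at hWM2
      calc (2 * θ ^ 2 * √(M * L)) ^ 2 = M * (4 * θ ^ 4 * L) := by
            rw [mul_pow, Real.sq_sqrt (by positivity)]; ring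
        _ ≤ M * (M * (1 - 1 / θ) ^ 2) := by gcongr
        _ = _ := by ring
    have e2 : N * h ≤ 1 / θ * M := by
      rw [div_mul_eq_mul_div, le_div_iff₀ hθ0]
      linarith
    rw [le_div_iff₀ hN0]
    linarith
  have hAb : ∀ x, 0 ≤ x → x ≤ M / N → |countIncr (fun i => U i ω) n 0 x| < n * b := by
    intro x hx0 hx1
    refine (hA x hx0 hx1).trans_le ?_
    -- The additional `θ` in `window` compensates for the sample size `n` being smaller than `N` by
    -- up to a factor `θ`.
    have : θ * (2 * θ * √(M * L)) ≤ θ * (n * b) := by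
      calc _ = N * b := by rw [hNb]; ring
        _ ≤ θ * n * b := by gcongr
        _ = _ := by ring
    exact le_of_mul_le_mul_left this hθ0
  refine (bkRemainder_le hpos hn0 hh hb0 hhb hAb
    (fun s x h1 h2 h3 h4 => (hB s x h1 h2 h3 h4).le)).trans (ENNReal.ofReal_le_ofReal ?_)
  rw [hNb, rRate, aRate, dRate]
  exact block_bound_le_rate hθ hn' hh hL0 hM1 hnh1 hlam0 hNn hM2 hL (by linarith) rfl

end Sample

end TailEmpirical

/-! ### Letting `θ` decrease to 1 -/

theorem theorem3 {Ω : Type*} [MeasurableSpace Ω] (P : Measure Ω) [IsProbabilityMeasure P]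
    (U : ℕ → Ω → ℝ) (hU_meas : ∀ i, Measurable (U i)) (hU_indep : iIndepFun U P)
    (hU_unif : ∀ i, pdf.IsUniform (U i) (Set.Icc 0 1) P volume)
    (hlow hupp : ℕ → ℝ)
    (hlow_cond : TailEmpirical.LocalStrongInvariance hlow)
    (hupp_cond : TailEmpirical.LocalStrongInvariance hupp)
    (hlow_lt : ∀ n : ℕ, 1 ≤ n → hlow n < hupp n / 2) :
    ∀ᵐ ω ∂P,
      limsup (fun n : ℕ => ⨆ h ∈ Set.Icc (hlow n) (hupp n),
        (ENNReal.ofReal (TailEmpirical.rRate n h))⁻¹ *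
          TailEmpirical.bkRemainder (fun i => U i ω) n h) atTop
        ≤ ENNReal.ofReal (Real.sqrt 2) := by
  have hU : TailEmpirical.IsUniformSample P U := ⟨hU_meas, hU_indep, hU_unif⟩
  -- Only the countably many values `θ = 1 + 1/(m+1)` are used, so that a single null set is
  -- discarded.
  have key : ∀ᵐ ω ∂P, ∀ m : ℕ, ∀ᶠ n : ℕ in atTop, ∀ h ∈ Set.Icc (hlow n) (hupp n),
      0 < TailEmpirical.rRate n h ∧ TailEmpirical.bkRemainder (fun i => U i ω) n h ≤
        ENNReal.ofReal (√2 * (1 + 1 / ((m : ℝ) + 1)) ^ 4 * TailEmpirical.rRate n h) := by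
    rw [ae_all_iff]
    intro m
    have : (0 : ℝ) < 1 / ((m : ℝ) + 1) := by positivity
    exact hU.ae_eventually_bkRemainder_le (by linarith) hlow_cond hupp_cond
  filter_upwards [key] with ω hω
  have hlim : Tendsto (fun m : ℕ => ENNReal.ofReal (√2 * (1 + 1 / ((m : ℝ) + 1)) ^ 4)) atTop
      (𝓝 (ENNReal.ofReal √2)) := by
    apply ENNReal.tendsto_ofReal
    have := ((tendsto_one_div_add_atTop_nhds_zero_nat (𝕜 := ℝ)).const_add 1).pow 4
    simpa using this.const_mul √2
  refine ge_of_tendsto' hlim fun m => ?_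
  refine limsup_le_of_le (by isBoundedDefault) ?_
  filter_upwards [hω m] with n hn
  refine iSup₂_le fun h hh => ?_
  obtain ⟨hr, hle⟩ := hn h hh
  have hr' : ENNReal.ofReal (TailEmpirical.rRate n h) ≠ 0 := (ENNReal.ofReal_pos.2 hr).ne'
  calc _ ≤ (ENNReal.ofReal (TailEmpirical.rRate n h))⁻¹ *
        ENNReal.ofReal (√2 * (1 + 1 / ((m : ℝ) + 1)) ^ 4 * TailEmpirical.rRate n h) := by gcongr
    _ = ENNReal.ofReal (√2 * (1 + 1 / ((m : ℝ) + 1)) ^ 4) := by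
        rw [ENNReal.ofReal_mul (by positivity), mul_comm, mul_assoc,
          ENNReal.mul_inv_cancel hr' ENNReal.ofReal_ne_top, mul_one]
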